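/- **Theorem (Estimation error of $f$).** There are an absolute constant $c>0$ and a function $C(f_{\max},\gamma)=K(1+f_{\max})^a(1+1/\gamma)^b$ with absolute constants $K>0$ and $a,b\in\mathbb{N}$ such that the following holds. *Model.* Let $1\le N\le T$. For $n\in[N]$ let $f_n:\{1,2,\dots\}\to\mathbb{R}$ be deterministic, and observe $y_n(t)=f_n(t)+x_n(t)$ for $t\in[T]$, where $(x_n(t))_{t\in\mathbb{Z}}$ satisfies $x_n(t)=\sum_{i=1}^{p_n}\alpha_{ni}x_n(t-i)+\eta_n(t)$ almost surely for all $t\in\mathbb Z$, with $p_n\ge1$ and $\alpha_{ni}\in\mathbb R$. For a series $g$, integers $1\le L\le T$ and $t_0\ge1$, the Page matrix $\mathbf Z(g,L,T,t_0)\in\mathbb{R}^{L\times\lfloor T/L\rfloor}$ has entries $g(t_0+i-1+(j-1)L)$. For series $g_1,\dots,g_N$, the stacked Page matrix is $\mathbf Z_g(t_0)=[\mathbf Z(g_1,L,T,t_0)\ \cdots\ \mathbf Z(g_N,L,T,t_0)]$. *Assumptions.* 1. (Spatial structure) $f_n(t)=\sum_{r=1}^R u_{nr}w_r(t)$ for all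 $n$ and $t\ge1$, with $u_{nr}\in\mathbb R$ and $w_r:\{1,2,\dots\}\to\mathbb R$. 2. (Temporal structure) $\operatorname{rank}\mathbf Z(w_r,L',T',t_0)\le G$ for all $r\in[R]$, $T'>1$, $1\le L'\le T'$, $t_0\ge1$. 3. (Stationarity and distinct roots) Each $x_n$ is second-order stationary. The roots $\lambda_{n1},\dots,\lambda_{np_n}\in\mathbb C$ of $z^{p_n}-\sum_{i=1}^{p_n}\alpha_{ni}z^{p_n-i}$ are distinct and satisfy $|\lambda_{ni}|<1$. 4. (Sub-gaussian noise) The $\eta_n(t)$, $n\in[N]$, $t\in\mathbb Z$, are i.i.d. with mean zero and sub-gaussian with variance proxy $\sigma^2$, $\sigma\ge0$: $\mathbb E\,e^{s\eta_n(t)}\le e^{\sigma^2s^2/2}$ for all $s\in\mathbb R$. 5. (Balanced spectra) $\gamma>0$, and for every $t_0\ge1$ for which $k(t_0)=\operatorname{rank}\mathbf Z_f(t_0)\ge 1$, the $k(t_0)$-th largest singular value of $\mathbf Z_f(t_0)$ is at least $\gamma\sqrt{NT}/\sqrt{k(t_0)}$. *Estimator.* Let $L=\sqrt{NT}$ be an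 integer that divides $T$, and let $\hat k=k=\operatorname{rank}\mathbf Z_f(1)$. The mSSA estimate $\hat f_n(t)$, $n\in[N]$, $t\in[T]$, is read off from the matrix that retains the top $\hat k$ terms of a singular value decomposition $\sum_\ell s_\ell u_\ell v_\ell^\top$ ($s_1\ge s_2\ge\dots\ge0$) of $\mathbf Z_y(1)$: it is the entry in row $((t-1)\bmod L)+1$ and column $\lceil t/L\rceil$ of the $n$-th block. *Conclusion.* Put $f_{\max}=\max_{n,\,t\le 2T}|f_n(t)|$, $\lambda_\star=\max_{n,i}|\lambda_{ni}|$, $c_\lambda=\max_n\sum_{i=1}^{p_n}\Big|\prod_{j\ne i}\frac{\lambda_{ni}}{\lambda_{ni}-\lambda_{nj}}\Big|$ and $\sigma_x=\frac{c_\lambda\sigma}{1-\lambda_\star}$. Then for every $n\in[N]$, with probability at least $1-\frac{c}{(NT)^{10}}$, $$\frac1T\sum_{t=1}^T\big(\hat f_n(t)-f_n(t)\big)^2\ \le\ C(f_{\max},\gamma)\,\frac{\max\{\sigma_x^2,\sigma_x^4\}\,G\,R\,\log(NT)}{\sqrt{NT}} .$$ In particular, for $\sigma_x\ge1$ the bound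 is $C(f_{\max},\gamma)\,\sigma_x^4\,GR\log(NT)/\sqrt{NT}$. -/

import Mathlib

open MeasureTheory ProbabilityTheory
open scoped NNReal ENNReal

universe u

noncomputable section

namespace SAMoSSA

/-! ### Page matrices -/

/-- The `L × ⌊T/L⌋` Page matrix of the `T` entries `g t₀, …, g (t₀ + T - 1)`
(rows and columns are numbered from `0`). -/
def pageMatrix (g : ℕ → ℝ) (L T t₀ : ℕ) : Matrix (Fin L) (Fin (T / L)) ℝ :=
  fun i j => g (t₀ + i + j * L)

/-- The stacked Page matrix `[Z(f₁) Z(f₂) ⋯ Z(f_N)]`; the column `(n, j)` is the `j`-th column of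
the Page matrix of the `n`-th series. -/
def stackedPage {N : ℕ} (f : Fin N → ℕ → ℝ) (L T t₀ : ℕ) :
    Matrix (Fin L) (Fin N × Fin (T / L)) ℝ :=
  fun i c => pageMatrix (f c.1) L T t₀ i c.2

/-! ### The deterministic components -/

/-- Each `f_n` is the linear combination with coefficients `coef n r` of the fundamental series
`w r`; time runs over the positive integers. -/
def SpatialStructure {N R : ℕ} (f : Fin N → ℕ → ℝ) (coef : Fin N → Fin R → ℝ)
    (w : Fin R → ℕ → ℝ) : Prop :=
  ∀ n : Fin N, ∀ t : ℕ, 1 ≤ t → f n t = ∑ r, coef n r * w r t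

/-- All Page matrices of all fundamental series have rank at most `G`. -/
def TemporalStructure {R : ℕ} (w : Fin R → ℕ → ℝ) (G : ℕ) : Prop :=
  ∀ r : Fin R, ∀ T L t₀ : ℕ, 1 < T → 1 ≤ L → L ≤ T → 1 ≤ t₀ → (pageMatrix (w r) L T t₀).rank ≤ G

/-- Balanced spectra: for every `t₀ ≥ 1`, if the stacked Page matrix started at `t₀` has rank
`k ≥ 1`, then its `k`-th largest singular value is at least `γ √(NT) / √k`. Here `k = j + 1`;
Mathlib numbers singular values from `0`, so that the `k`-th one has index `j`. -/
def BalancedSpectra {N : ℕ} (f : Fin N → ℕ → ℝ) (L T : ℕ) (γ : ℝ) : Prop :=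
  ∀ t₀ : ℕ, 1 ≤ t₀ → ∀ j : ℕ, (stackedPage f L T t₀).rank = j + 1 →
    γ * √((N : ℝ) * T) / √((j : ℝ) + 1) ≤
      (Matrix.toEuclideanLin (stackedPage f L T t₀)).singularValues j

/-- `f_max = max_{n, 1 ≤ t ≤ 2T} |f_n(t)|`. -/
def fMax {N : ℕ} (f : Fin N → ℕ → ℝ) (T : ℕ) : ℝ≥0 :=
  (Finset.univ ×ˢ Finset.Icc 1 (2 * T)).sup fun q : Fin N × ℕ => ‖f q.1 q.2‖₊

/-! ### The autoregressive noise -/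

/-- The characteristic polynomial `z^p - ∑_{i=1}^p α_i z^{p-i}` (the coefficient `α_i` is
`a ⟨i - 1, _⟩`). -/
def charPoly {p : ℕ} (a : Fin p → ℝ) : Polynomial ℂ :=
  Polynomial.X ^ p - ∑ i : Fin p, Polynomial.C (a i : ℂ) * Polynomial.X ^ (p - 1 - (i : ℕ))

/-- The set of roots of the characteristic polynomial. -/
def rootSet {p : ℕ} (a : Fin p → ℝ) : Finset ℂ := (charPoly a).roots.toFinset

/-- `λ_⋆ = max_{n,i} |λ_{ni}|`. -/
def lambdaStar {N : ℕ} {p : Fin N → ℕ} (α : ∀ n, Fin (p n) → ℝ) : ℝ≥0 :=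
  Finset.univ.sup fun n => (rootSet (α n)).sup fun z => ‖z‖₊

/-- `c_λ = max_n ∑_i |∏_{j ≠ i} λ_{ni} / (λ_{ni} - λ_{nj})|`. The factors are
`(1 - λ_{nj} / λ_{ni})⁻¹`, written so that they also make sense for a root `λ_{ni} = 0`. -/
def cLambda {N : ℕ} {p : Fin N → ℕ} (α : ∀ n, Fin (p n) → ℝ) : ℝ≥0 :=
  Finset.univ.sup fun n => ∑ z ∈ rootSet (α n), ‖∏ z' ∈ (rootSet (α n)).erase z, z / (z - z')‖₊

/-- `σ_x = c_λ σ / (1 - λ_⋆)`. -/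
def sigmaX {N : ℕ} {p : Fin N → ℕ} (α : ∀ n, Fin (p n) → ℝ) (σ : ℝ≥0) : ℝ :=
  (cLambda α : ℝ) * σ / (1 - (lambdaStar α : ℝ))

/-- Second-order stationarity: constant mean, and autocovariances depending only on the lag. -/
def IsStationary {Ω : Type u} [MeasurableSpace Ω] (μ : Measure Ω) (x : ℤ → Ω → ℝ) : Prop :=
  (∀ t, MemLp (x t) 2 μ) ∧
  ∃ m : ℝ, (∀ t, ∫ ω, x t ω ∂μ = m) ∧
    ∃ ρ : ℤ → ℝ, ∀ t j, ∫ ω, (x t ω - m) * (x (t + j) ω - m) ∂μ = ρ j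

/-- For every `n`, `x_n` is a stationary process with
`x_n(t) = ∑_{i=1}^{p_n} α_{ni} x_n(t - i) + η_n(t)` almost surely, and the roots of its
characteristic polynomial are distinct and of modulus less than `1`. -/
structure StationaryAR {Ω : Type u} [MeasurableSpace Ω] (μ : Measure Ω) {N : ℕ} {p : Fin N → ℕ}
    (α : ∀ n, Fin (p n) → ℝ) (η x : Fin N → ℤ → Ω → ℝ) : Prop where
  stationary : ∀ n, IsStationary μ (x n)
  recursion : ∀ n t, ∀ᵐ ω ∂μ,
    x n t ω = ∑ i : Fin (p n), α n i * x n (t - ((i : ℤ) + 1)) ω + η n t ω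
  norm_root_lt_one : ∀ n, ∀ z ∈ (charPoly (α n)).roots, ‖z‖ < 1
  distinct_roots : ∀ n, (charPoly (α n)).roots.Nodup

/-- The per-step noise variables `η_n(t)` are i.i.d. over all pairs `(n, t)`, have mean zero, and
are sub-gaussian with variance proxy `σ²`, i.e. `E exp(s η) ≤ exp(σ² s² / 2)` for all real `s`. -/
structure SubgaussianNoise {Ω : Type u} [MeasurableSpace Ω] (μ : Measure Ω) {N : ℕ}
    (η : Fin N → ℤ → Ω → ℝ) (σ : ℝ≥0) : Prop where
  indep : iIndepFun (fun q : Fin N × ℤ => η q.1 q.2) μ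
  ident : ∀ q q' : Fin N × ℤ, IdentDistrib (η q.1 q.2) (η q'.1 q'.2) μ μ
  mean_zero : ∀ n t, ∫ ω, η n t ω ∂μ = 0
  subgaussian : ∀ n t, HasSubgaussianMGF (η n t) (σ ^ 2) μ

/-- The observations `y_n(t) = f_n(t) + x_n(t)` for the outcome `ω`. -/
def observation {Ω : Type u} {N : ℕ} (f : Fin N → ℕ → ℝ) (x : Fin N → ℤ → Ω → ℝ) (ω : Ω) :
    Fin N → ℕ → ℝ :=
  fun n t => f n t + x n (t : ℤ) ω

/-! ### The estimator -/

/-- `Yhat` arises from `Y` by hard singular value thresholding with threshold `k`: for some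
singular value decomposition `Y = ∑_ℓ s_ℓ u_ℓ v_ℓᵀ` with `s_1 ≥ s_2 ≥ ⋯ ≥ 0`, only the top `k`
terms are retained. -/
def IsHSVT {m n : Type*} [Fintype m] [Fintype n] (k : ℕ) (Y Yhat : Matrix m n ℝ) : Prop :=
  ∃ (r : ℕ) (s : Fin r → ℝ) (u : Fin r → EuclideanSpace ℝ m) (v : Fin r → EuclideanSpace ℝ n),
    Orthonormal ℝ u ∧ Orthonormal ℝ v ∧ Antitone s ∧ (∀ l, 0 ≤ s l) ∧
    (∀ i j, Y i j = ∑ l, s l * u l i * v l j) ∧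
    (∀ i j, Yhat i j = ∑ l : Fin r, if (l : ℕ) < k then s l * u l i * v l j else 0)

/-- `fhat` is an mSSA estimate from the data `y` with parameters `L` and `k` (where `L ∣ T`): the
entry `fhat n t`, `1 ≤ t ≤ T`, is read off in row `((t - 1) mod L) + 1` and column `⌈t / L⌉` of the
`n`-th block of the matrix obtained by HSVT from the stacked Page matrix of `y`, i.e. that matrix
is the stacked Page matrix of `fhat`. -/
def IsMSSAEstimate {N : ℕ} (L T k : ℕ) (y fhat : Fin N → ℕ → ℝ) : Prop :=
  IsHSVT k (stackedPage y L T 1) (stackedPage fhat L T 1)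

/-- `EstErr(N, T, n) = (1/T) ∑_{t=1}^T (fhat_n(t) - f_n(t))²`. -/
def estErr {N : ℕ} (T : ℕ) (fhat f : Fin N → ℕ → ℝ) (n : Fin N) : ℝ :=
  1 / (T : ℝ) * ∑ t ∈ Finset.Icc 1 T, (fhat n t - f n t) ^ 2

end SAMoSSA

end

/-! Let A and X be the stacked Page matrices of the signal and of the noise, so that the data matrix
is Y = A + X; since L² = NT, all of them are L × L. Let P project onto the column space of A and Q
onto the span of the top k left singular vectors of Y. The estimate is QY, and on an input b its
error splits as QPXb + Q(1 − P)Xb − (1 − Q)Ab. If ‖X‖ ≤ B and the least nonzero singular value of A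
is at least d, then arguments of Weyl and Wedin type bound the last two terms by κ‖Xb‖ and κ‖Ab‖
with κ = 2B/d (`hsvt_error`).

Here B is of order σ_x √L and d = γL/√k, so κ² is of order σ_x² k/(γ²L). Columns of X and A have
squared norm at most B² and f_max² L, so L cancels; the product κ²B² is the source of σ_x⁴. The
first term sees only k fixed directions and costs k σ_x² log L. Averaging over the L entries of a
column gives the factor 1/L, and k ≤ GR by `rank_stackedPage_le`.

The probabilistic core is `hasSubgaussianMGF_noise`: although the noise is dependent in time, a
linear combination with coefficient vector c is sub-gaussian with parameter σ_x ‖c‖. Partial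
fractions exhibit x_n as an L¹ limit of moving averages with weights at most c_λ λ_⋆^h. For one lag
h the innovations involved are independent; over different lags the parameters simply add, which
gives a geometric series. Union bounds over two nets (`measure_noiseMap_norm_le`) and over a basis
of the signal space (`measure_starProjection_noiseMap_le`) then give the two good events. -/

noncomputable section

namespace SAMoSSA

open Module Filter Topology
open scoped InnerProductSpace

/-! ### Deterministic perturbation theory for truncated singular value decompositions. -/

section LinearAlgebra

variable {E F : Type*} [NormedAddCommGroup E] [InnerProductSpace ℝ E] [FiniteDimensional ℝ E]
  [NormedAddCommGroup F] [InnerProductSpace ℝ F] [FiniteDimensional ℝ F]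

/-- On the orthogonal complement of its kernel, a linear map is bounded below by its smallest
nonzero singular value. -/
theorem singularValues_mul_norm_le (A : E →ₗ[ℝ] F) {j : ℕ} (hj : finrank ℝ A.range = j + 1)
    {a : E} (ha : a ∈ A.kerᗮ) : A.singularValues j * ‖a‖ ≤ ‖A a‖ := by
  set hT := A.isSymmetric_adjoint_comp_self with hTdef
  set b := hT.eigenvectorBasis rfl
  have h1 : ‖A a‖ ^ 2 = ∑ i : Fin (finrank ℝ E), (A.singularValues i) ^ 2 * ⟪b i, a⟫_ℝ ^ 2 := by
    rw [← real_inner_self_eq_norm_sq, ← LinearMap.adjoint_inner_right, ← b.sum_inner_mul_inner]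
    refine Finset.sum_congr rfl fun i _ => ?_
    have : ⟪b i, A.adjoint (A a)⟫_ℝ = A.singularValues i ^ 2 * ⟪b i, a⟫_ℝ := by
      have h := hT.eigenvectorBasis_apply_self_apply rfl a i
      rw [OrthonormalBasis.repr_apply_apply, OrthonormalBasis.repr_apply_apply] at h
      rw [A.sq_singularValues_fin rfl]
      exact h
    rw [this, real_inner_comm]; ring
  have h2 : ‖a‖ ^ 2 = ∑ i : Fin (finrank ℝ E), ⟪b i, a⟫_ℝ ^ 2 := by
    rw [← b.sum_sq_norm_inner_right]; simp
  refine le_of_sq_le_sq ?_ (norm_nonneg _)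
  rw [mul_pow, h1, h2, Finset.mul_sum]
  refine Finset.sum_le_sum fun i _ => ?_
  by_cases hi : (i : ℕ) ≤ j
  · have := A.singularValues_antitone hi
    have h0 := A.singularValues_nonneg j
    gcongr
  -- Beyond the rank the eigenvector lies in the kernel, to which `a` is orthogonal.
  · have h0 : A.singularValues i = 0 := by
      rw [A.singularValues_eq_zero_iff_le_finrank_range]; omega
    have hk : b i ∈ A.ker := by
      rw [LinearMap.mem_ker, ← norm_eq_zero, ← sq_eq_zero_iff, ← real_inner_self_eq_norm_sq,
        ← LinearMap.adjoint_inner_right]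
      have := hT.apply_eigenvectorBasis rfl i
      rw [← A.sq_singularValues_fin rfl, h0] at this
      have h3 : A.adjoint (A (b i)) = 0 := by
        refine Eq.trans ?_ (this.trans ?_)
        · rfl
        · norm_num
      rw [h3, inner_zero_right]
    rw [Submodule.inner_right_of_mem_orthogonal hk ha]
    simp

variable {r : ℕ} {s : Fin r → ℝ} {u : Fin r → F} {v : Fin r → E}

omit [FiniteDimensional ℝ F] in
theorem norm_sq_sum_smul_orthonormal {ι : Type*} {u : ι → F} (hu : Orthonormal ℝ u)
    (t : Finset ι) (c : ι → ℝ) :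
    ‖∑ l ∈ t, c l • u l‖ ^ 2 = ∑ l ∈ t, c l ^ 2 := by
  rw [← real_inner_self_eq_norm_sq, hu.inner_sum]
  simp [sq]

omit [FiniteDimensional ℝ F] in
/-- Lower Weyl bound: a linear map bounded below by `d` on a space of dimension larger than `m`
has its singular value number `m` at least `d`. -/
theorem le_svd_of_bounded_below (hu : Orthonormal ℝ u) (hv : Orthonormal ℝ v) (hs : Antitone s)
    (hs0 : ∀ l, 0 ≤ s l) {Y : E →ₗ[ℝ] F} (hY : ∀ b, Y b = ∑ l, (s l * ⟪v l, b⟫_ℝ) • u l)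
    (V : Submodule ℝ E) {m : ℕ} (hm : m < finrank ℝ V) {d : ℝ} (hd : 0 < d)
    (hV : ∀ a ∈ V, d * ‖a‖ ≤ ‖Y a‖) : ∃ h : m < r, d ≤ s ⟨m, h⟩ := by
  -- `V` has dimension above `m`, so it contains a nonzero vector orthogonal to the first `m` of the
  -- `v l`; functionals with index at least `r` are set to zero.
  let φ : V →ₗ[ℝ] (Fin m → ℝ) :=
    LinearMap.pi fun i => if h : (i : ℕ) < r then
      (innerₛₗ ℝ (v ⟨i, h⟩)).comp V.subtype else 0
  have hφ : φ.ker ≠ ⊥ := LinearMap.ker_ne_bot_of_finrank_lt (by simpa using hm)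
  obtain ⟨a, haφ, ha0⟩ := (Submodule.ne_bot_iff _).1 hφ
  have hva : ∀ l : Fin r, (l : ℕ) < m → ⟪v l, (a : E)⟫_ℝ = 0 := by
    intro l hl
    have := congrFun (LinearMap.mem_ker.1 haφ) ⟨l, hl⟩
    simpa [φ] using this
  have hYa : ‖Y a‖ ^ 2 = ∑ l, (s l * ⟪v l, (a : E)⟫_ℝ) ^ 2 := by
    rw [hY, norm_sq_sum_smul_orthonormal hu]
  have hna : 0 < ‖(a : E)‖ := by simpa using ha0
  have hlow := hV a a.2
  have hpos : 0 < ‖Y a‖ ^ 2 := by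
    have : 0 < d * ‖(a : E)‖ := by positivity
    have : 0 < ‖Y a‖ := by linarith
    positivity
  have hmr : m < r := by
    by_contra hmr
    rw [hYa] at hpos
    refine hpos.ne' (Finset.sum_eq_zero fun l _ => ?_)
    rw [hva l (by omega)]; simp
  refine ⟨hmr, ?_⟩
  have hup : ‖Y a‖ ^ 2 ≤ (s ⟨m, hmr⟩ * ‖(a : E)‖) ^ 2 := by
    have hb := hv.sum_inner_products_le (x := (a : E)) (s := Finset.univ)
    rw [hYa, mul_pow]
    refine le_trans ?_ (mul_le_mul_of_nonneg_left hb (by positivity))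
    rw [Finset.mul_sum]
    refine Finset.sum_le_sum fun l _ => ?_
    rw [mul_pow, Real.norm_eq_abs, sq_abs]
    by_cases hl : (l : ℕ) < m
    · rw [hva l hl]; simp
    · have := hs (show (⟨m, hmr⟩ : Fin r) ≤ l from not_lt.1 hl)
      have h0 := hs0 l
      gcongr
  have := le_of_sq_le_sq hup (mul_nonneg (hs0 _) (norm_nonneg _))
  exact le_of_mul_le_mul_right (hlow.trans this) hna

omit [FiniteDimensional ℝ F] in
/-- Upper Weyl bound: singular values with index at least the rank of `A` are at most the size of
the perturbation. -/
theorem svd_le_of_perturbation (hu : Orthonormal ℝ u) (hv : Orthonormal ℝ v) (hs : Antitone s)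
    (hs0 : ∀ l, 0 ≤ s l) {A Y : E →ₗ[ℝ] F}
    (hY : ∀ b, Y b = ∑ l, (s l * ⟪v l, b⟫_ℝ) • u l) {B : ℝ}
    (hB : ∀ b, ‖Y b - A b‖ ≤ B * ‖b‖) (l : Fin r) (hl : finrank ℝ A.range ≤ l) : s l ≤ B := by
  -- The first `l + 1` right singular vectors span more dimensions than the rank of `A`, so some
  -- nonzero combination is killed by `A`; on it `Y` acts as the perturbation alone.
  let g : Fin ((l : ℕ) + 1) → Fin r := fun i => ⟨i, by omega⟩
  have hg : Function.Injective g := fun i j h => by simpa [g, Fin.ext_iff] using h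
  let Φ : (Fin ((l : ℕ) + 1) → ℝ) →ₗ[ℝ] E := Fintype.linearCombination ℝ (fun i => v (g i))
  let ψ : (Fin ((l : ℕ) + 1) → ℝ) →ₗ[ℝ] A.range := A.rangeRestrict.comp Φ
  have hψ : ψ.ker ≠ ⊥ := LinearMap.ker_ne_bot_of_finrank_lt (by simp; omega)
  obtain ⟨c, hcψ, hc0⟩ := (Submodule.ne_bot_iff _).1 hψ
  have hA : A (Φ c) = 0 := by
    have := congrArg Subtype.val (LinearMap.mem_ker.1 hcψ)
    simpa [ψ] using this
  have hvg : Orthonormal ℝ (fun i => v (g i)) := hv.comp g hg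
  have hΦ : Φ c = ∑ i, c i • v (g i) := by simp [Φ, Fintype.linearCombination_apply]
  have hn : ‖Φ c‖ ^ 2 = ∑ i, c i ^ 2 := by rw [hΦ, norm_sq_sum_smul_orthonormal hvg]
  have hpos : 0 < ‖Φ c‖ := by
    rw [norm_pos_iff]
    intro h
    rw [h] at hn
    apply hc0
    ext i
    have := (Finset.sum_eq_zero_iff_of_nonneg (fun i _ => sq_nonneg (c i))).1
      (by rw [← hn]; simp) i (Finset.mem_univ _)
    simpa using this
  have hYc : (s l * ‖Φ c‖) ^ 2 ≤ ‖Y (Φ c)‖ ^ 2 := by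
    rw [hY, norm_sq_sum_smul_orthonormal hu, mul_pow, hn, Finset.mul_sum]
    calc ∑ i, s l ^ 2 * c i ^ 2 ≤ ∑ i, (s (g i) * ⟪v (g i), Φ c⟫_ℝ) ^ 2 := by
          refine Finset.sum_le_sum fun i _ => ?_
          rw [hΦ, hvg.inner_right_fintype, mul_pow]
          have := hs (show g i ≤ l from Nat.lt_succ_iff.1 i.2)
          have h0 := hs0 l
          gcongr
      _ = ∑ m ∈ Finset.univ.map ⟨g, hg⟩, (s m * ⟪v m, Φ c⟫_ℝ) ^ 2 := by simp
      _ ≤ _ := Finset.sum_le_univ_sum_of_nonneg fun m => sq_nonneg _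
  have h1 := le_of_sq_le_sq hYc (norm_nonneg _)
  have h2 := hB (Φ c)
  rw [hA, sub_zero] at h2
  exact le_of_mul_le_mul_right (h1.trans h2) hpos

/-- Column-wise error of hard singular value thresholding. -/
theorem hsvt_error (hu : Orthonormal ℝ u) (hv : Orthonormal ℝ v) (hs : Antitone s)
    (hs0 : ∀ l, 0 ≤ s l) {A X : E →ₗ[ℝ] F}
    (hY : ∀ b, A b + X b = ∑ l, (s l * ⟪v l, b⟫_ℝ) • u l) {B d : ℝ} (hd : 0 < d)
    (hB : ∀ b, ‖X b‖ ≤ B * ‖b‖) (hA : ∀ a ∈ A.kerᗮ, d * ‖a‖ ≤ ‖A a‖) (b : E) (hB0 : 0 ≤ B) :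
    ‖(∑ l ∈ Finset.univ.filter (fun l : Fin r => (l : ℕ) < finrank ℝ A.range), (s l * ⟪v l, b⟫_ℝ) • u l) - A b‖ ^ 2 ≤
      4 * ‖A.range.starProjection (X b)‖ ^ 2 + 4 * (2 * B / d) ^ 2 * ‖X b‖ ^ 2 +
        2 * (2 * B / d) ^ 2 * ‖A b‖ ^ 2 := by
  set k := finrank ℝ A.range with hk
  set P := A.range.starProjection with hP
  set U : Submodule ℝ F := Submodule.span ℝ (u '' {l | (l : ℕ) < k}) with hU
  set Q := U.starProjection with hQ
  set κ := 2 * B / d with hκ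
  have hκ0 : 0 ≤ κ := by positivity
  have hQu : ∀ l, Q (u l) = if (l : ℕ) < k then u l else 0 := by
    intro l
    split_ifs with h
    · exact Submodule.starProjection_eq_self_iff.2 (Submodule.subset_span ⟨l, h, rfl⟩)
    · rw [hQ, Submodule.starProjection_apply_eq_zero_iff, hU, Submodule.mem_orthogonal]
      intro w hw
      induction hw using Submodule.span_induction with
      | mem x hx =>
        obtain ⟨m, hm, rfl⟩ := hx
        exact hu.2 (by rintro rfl; exact h hm)
      | zero => simp
      | add x y _ _ hx hy => rw [inner_add_left, hx, hy, add_zero]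
      | smul a x _ hx => rw [inner_smul_left, hx, mul_zero]
  have hQY : ∀ b, Q (A b + X b) = ∑ l ∈ Finset.univ.filter (fun l : Fin r => (l : ℕ) < k), (s l * ⟪v l, b⟫_ℝ) • u l := by
    intro b
    rw [hY, map_sum, Finset.sum_filter]
    refine Finset.sum_congr rfl fun l _ => ?_
    rw [map_smul, hQu]; split_ifs <;> simp
  have hQn : ∀ z, ‖Q z‖ ≤ ‖z‖ := fun z => Submodule.norm_starProjection_apply_le U z
  have hPn : ∀ z, ‖P z‖ ≤ ‖z‖ := fun z => Submodule.norm_starProjection_apply_le _ z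
  have hQcn : ∀ z, ‖z - Q z‖ ≤ ‖z‖ := fun z => by
    rw [hQ, ← Submodule.starProjection_orthogonal_val]
    exact Submodule.norm_starProjection_apply_le _ z
  have hPcn : ∀ z, ‖z - P z‖ ≤ ‖z‖ := fun z => by
    rw [hP, ← Submodule.starProjection_orthogonal_val]
    exact Submodule.norm_starProjection_apply_le _ z
  have hPA : ∀ b, P (A b) = A b := fun b =>
    Submodule.starProjection_eq_self_iff.2 (LinearMap.mem_range_self _ _)
  have hQsymm : ∀ x y, ⟪Q x, y⟫_ℝ = ⟪x, Q y⟫_ℝ := fun x y =>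
    Submodule.inner_starProjection_left_eq_right U x y
  have hPsymm : ∀ x y, ⟪P x, y⟫_ℝ = ⟪x, P y⟫_ℝ := fun x y =>
    Submodule.inner_starProjection_left_eq_right _ x y
  -- the part of the signal outside the estimated column space
  have hsig : ∀ b, ‖A b - Q (A b)‖ ≤ κ * ‖A b‖ := by
    intro b
    -- Dropping the kernel component does not change the image; on the rest ‖a‖ ≤ ‖A a‖ / d, which
    -- turns the absolute bound 2B‖a‖ into a relative one.
    obtain ⟨a0, h0, a, ha, rfl⟩ := A.ker.exists_add_mem_mem_orthogonal b
    rw [map_add, LinearMap.mem_ker.1 h0, zero_add]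
    have h1 : ‖(A a + X a) - Q (A a + X a)‖ ≤ B * ‖a‖ := by
      have e : (A a + X a) - Q (A a + X a) =
          ∑ l ∈ Finset.univ.filter (fun l : Fin r => ¬ (l : ℕ) < k), (s l * ⟪v l, a⟫_ℝ) • u l := by
        rw [hQY, hY, sub_eq_iff_eq_add, add_comm, Finset.sum_filter_add_sum_filter_not]
      refine le_of_sq_le_sq ?_ (by positivity)
      rw [e, norm_sq_sum_smul_orthonormal hu, mul_pow]
      have hb := hv.sum_inner_products_le (x := a)
        (s := Finset.univ.filter fun l : Fin r => ¬ (l : ℕ) < k)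
      refine le_trans ?_ (mul_le_mul_of_nonneg_left hb (by positivity))
      rw [Finset.mul_sum]
      refine Finset.sum_le_sum fun l hl => ?_
      have hl' : k ≤ l := not_lt.1 (Finset.mem_filter.1 hl).2
      have := svd_le_of_perturbation hu hv hs hs0 (Y := A + X) (A := A) (B := B) hY
        (fun b => by simpa using hB b) l hl'
      have h0 := hs0 l
      rw [mul_pow, Real.norm_eq_abs, sq_abs]
      gcongr
    have h2 : A a - Q (A a) = ((A a + X a) - Q (A a + X a)) - (X a - Q (X a)) := by
      rw [map_add]; abel
    have h3 : ‖A a - Q (A a)‖ ≤ B * ‖a‖ + B * ‖a‖ := by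
      rw [h2]
      exact (norm_sub_le _ _).trans (add_le_add h1 ((hQcn _).trans (hB a)))
    have h4 := hA a ha
    calc _ ≤ 2 * B * ‖a‖ := by linarith
      _ = κ * (d * ‖a‖) := by rw [hκ]; field_simp
      _ ≤ _ := by gcongr
  -- the part of the estimated column space outside the true one
  have hQP : ∀ z, ‖Q (z - P z)‖ ≤ κ * ‖z‖ := by
    intro z
    by_cases hBd : d < 2 * B
    · have : 1 ≤ κ := by rw [hκ, le_div_iff₀ hd]; linarith
      calc _ ≤ ‖z‖ := (hQn _).trans (hPcn _)
        _ ≤ _ := le_mul_of_one_le_left (norm_nonneg _) this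
    push Not at hBd
    have hsl : ∀ l : Fin r, (l : ℕ) < k → d / 2 ≤ s l := by
      intro l hl
      have hkk : finrank ℝ A.kerᗮ = k := by
        have h1 := Submodule.finrank_add_finrank_orthogonal A.ker
        have h2 := A.finrank_range_add_finrank_ker
        omega
      by_cases hB' : B < d
      · obtain ⟨hm, hm'⟩ := le_svd_of_bounded_below hu hv hs hs0 (Y := A + X) hY A.kerᗮ
          (m := l) (by omega) (d := d - B) (by linarith) (fun a ha => by
            have h1 := hA a ha
            have h2 := hB a
            have h3 : ‖A a‖ ≤ ‖A a + X a‖ + ‖X a‖ := by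
              simpa using norm_sub_le (A a + X a) (X a)
            simp only [LinearMap.add_apply]
            linarith)
        have : s ⟨l, hm⟩ = s l := rfl
        linarith
      · exfalso; linarith
    -- A vector of the estimated space is `A b' + X b'` with ‖b'‖ ≤ (2/d)‖w‖, and 1 − P annihilates
    -- the part `A b'`.
    have hout : ∀ w, Q w = w → ‖w - P w‖ ≤ κ * ‖w‖ := by
      intro w hw
      have hsum : w = ∑ l ∈ Finset.univ.filter (fun l : Fin r => (l : ℕ) < k), ⟪u l, w⟫_ℝ • u l := by
        have hwU : w ∈ U := Submodule.starProjection_eq_self_iff.1 hw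
        clear hw
        rw [hU] at hwU
        induction hwU using Submodule.span_induction with
        | mem x hx =>
          obtain ⟨m, hm, rfl⟩ := hx
          rw [Finset.sum_eq_single m]
          · simp [hu.1 m]
          · intro l _ hlm
            rw [hu.2 hlm, zero_smul]
          · intro h; exact absurd (Finset.mem_filter.2 ⟨Finset.mem_univ _, hm⟩) h
        | zero => simp
        | add x y _ _ hx hy =>
          simp only [inner_add_right, add_smul, Finset.sum_add_distrib]
          rw [← hx, ← hy]
        | smul a x _ hx =>
          simp only [inner_smul_right, mul_smul, ← Finset.smul_sum]
          rw [← hx]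
      set b' : E := ∑ l ∈ Finset.univ.filter (fun l : Fin r => (l : ℕ) < k), (⟪u l, w⟫_ℝ / s l) • v l with hb'
      have hvb : ∀ l : Fin r, ⟪v l, b'⟫_ℝ = if (l : ℕ) < k then ⟪u l, w⟫_ℝ / s l else 0 := by
        intro l
        rw [hb', Finset.sum_filter]
        have : (∑ a : Fin r, if (a : ℕ) < k then (⟪u a, w⟫_ℝ / s a) • v a else 0) =
            ∑ a : Fin r, (if (a : ℕ) < k then ⟪u a, w⟫_ℝ / s a else 0) • v a :=
          Finset.sum_congr rfl fun a _ => by split_ifs <;> simp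
        rw [this, hv.inner_right_fintype]
      have hYb : A b' + X b' = w := by
        rw [hY]
        conv_rhs => rw [hsum]
        rw [Finset.sum_filter]
        refine Finset.sum_congr rfl fun l _ => ?_
        rw [hvb]
        split_ifs with h
        · have := hsl l h
          rw [mul_div_cancel₀ _ (by linarith : s l ≠ 0)]
        · simp
      have hbn : ‖b'‖ ≤ 2 / d * ‖w‖ := by
        refine le_of_sq_le_sq ?_ (by positivity)
        have hb := hu.sum_inner_products_le (x := w)
          (s := Finset.univ.filter fun l : Fin r => (l : ℕ) < k)
        rw [hb', norm_sq_sum_smul_orthonormal hv, mul_pow]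
        refine le_trans ?_ (mul_le_mul_of_nonneg_left hb (by positivity))
        rw [Finset.mul_sum]
        refine Finset.sum_le_sum fun l hl => ?_
        have := hsl l (Finset.mem_filter.1 hl).2
        rw [Real.norm_eq_abs, sq_abs, div_eq_mul_inv, mul_pow, mul_comm]
        have h2 : (s l)⁻¹ ≤ 2 / d := by
          rw [show 2 / d = (d / 2)⁻¹ by rw [inv_div]]
          exact inv_anti₀ (by positivity) this
        have h3 : 0 ≤ (s l)⁻¹ := inv_nonneg.2 (hs0 l)
        gcongr
      have e : w - P w = X b' - P (X b') := by
        conv_lhs => rw [← hYb]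
        rw [map_add, hPA]; abel
      calc _ = ‖X b' - P (X b')‖ := by rw [e]
        _ ≤ B * ‖b'‖ := (hPcn _).trans (hB _)
        _ ≤ B * (2 / d * ‖w‖) := by gcongr
        _ = κ * ‖w‖ := by rw [hκ]; ring
    -- Duality: Q(1 − P) is the adjoint of (1 − P)Q, which `hout` has just bounded.
    set w := Q (z - P z) with hw
    have hQw : Q w = w := by
      rw [hw]; exact Submodule.starProjection_eq_self_iff.2 (Submodule.starProjection_apply_mem _ _)
    have h1 : ‖w‖ ^ 2 = ⟪w - P w, z⟫_ℝ := by
      rw [← real_inner_self_eq_norm_sq]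
      conv_lhs => rw [hw, hQsymm, ← hw, hQw]
      rw [inner_sub_left, hPsymm, ← inner_sub_right, real_inner_comm]
    have h2 : ‖w‖ ^ 2 ≤ κ * ‖w‖ * ‖z‖ := by
      rw [h1]
      exact (real_inner_le_norm _ _).trans (by gcongr; exact hout w hQw)
    rcases (norm_nonneg w).eq_or_lt with h0 | h0
    · rw [← h0]; positivity
    · nlinarith
  have key : (∑ l ∈ Finset.univ.filter (fun l : Fin r => (l : ℕ) < k), (s l * ⟪v l, b⟫_ℝ) • u l) - A b =
      (Q (P (X b)) + Q (X b - P (X b))) - (A b - Q (A b)) := by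
    rw [← hQY, map_add, map_sub]; abel
  have t1 := (hQn (P (X b)))
  have t2 := hQP (X b)
  have t3 := hsig b
  have t : ‖(∑ l ∈ Finset.univ.filter (fun l : Fin r => (l : ℕ) < k), (s l * ⟪v l, b⟫_ℝ) • u l) - A b‖ ≤
      ‖P (X b)‖ + κ * ‖X b‖ + κ * ‖A b‖ := by
    rw [key]
    exact (norm_sub_le _ _).trans (add_le_add ((norm_add_le _ _).trans (add_le_add t1 t2)) t3)
  calc _ ≤ (‖P (X b)‖ + κ * ‖X b‖ + κ * ‖A b‖) ^ 2 := by gcongr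
    _ ≤ _ := by
      nlinarith [sq_nonneg (‖P (X b)‖ + κ * ‖X b‖ - κ * ‖A b‖),
        sq_nonneg (‖P (X b)‖ - κ * ‖X b‖)]

end LinearAlgebra

/-! ### Moving average expansion of an autoregression by partial fractions. -/

section Autoregression

variable {p : ℕ}

theorem degree_sum_C_mul_X_pow_lt (a : Fin p → ℝ) :
    (∑ i : Fin p, Polynomial.C (a i : ℂ) * Polynomial.X ^ (p - 1 - (i : ℕ))).degree <
      (p : WithBot ℕ) := by
  refine (Polynomial.degree_sum_le _ _).trans_lt ?_
  refine (Finset.sup_lt_iff (WithBot.bot_lt_coe p)).2 fun i _ => ?_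
  refine (Polynomial.degree_C_mul_X_pow_le _ _).trans_lt ?_
  exact WithBot.coe_lt_coe.2 (by omega : p - 1 - (i : ℕ) < p)

theorem charPoly_monic (a : Fin p → ℝ) : (charPoly a).Monic :=
  Polynomial.monic_X_pow_sub (degree_sum_C_mul_X_pow_lt a)

theorem charPoly_natDegree (a : Fin p → ℝ) : (charPoly a).natDegree = p := by
  rw [charPoly, Polynomial.natDegree_eq_of_degree_eq (Polynomial.degree_sub_eq_left_of_degree_lt
    (by rw [Polynomial.degree_X_pow]; exact degree_sum_C_mul_X_pow_lt a)),
    Polynomial.natDegree_X_pow]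

/-- Distinctness is what allows the multiset of roots to be replaced by a finite set. -/
theorem charPoly_eq_prod (a : Fin p → ℝ) (hd : (charPoly a).roots.Nodup) :
    charPoly a = ∏ z ∈ rootSet a, (Polynomial.X - Polynomial.C z) := by
  have h := (IsAlgClosed.splits (charPoly a)).eq_prod_roots_of_monic (charPoly_monic a)
  conv_lhs => rw [h]
  rw [rootSet, Finset.prod, Multiset.toFinset_val, hd.dedup]

theorem card_rootSet (a : Fin p → ℝ) (hd : (charPoly a).roots.Nodup) :
    (rootSet a).card = p := by
  have h := congrArg Polynomial.natDegree (charPoly_eq_prod a hd)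
  rw [charPoly_natDegree, Polynomial.natDegree_prod_of_monic _ _
    fun z _ => Polynomial.monic_X_sub_C z] at h
  simpa using h.symm

/-- The coefficient of `1 / (1 - zB)` in the partial fraction expansion of the inverse of
`∏ (1 - z'B)`. -/
def partialFractionCoeff (S : Finset ℂ) (z : ℂ) : ℂ := ∏ z' ∈ S.erase z, z / (z - z')

/-- Lagrange interpolation of X^(|S|−1) at the nodes `S`. This is the partial fraction identity with
denominators cleared, so a zero root needs no special treatment. -/
theorem sum_partialFractionCoeff_mul (S : Finset ℂ) (hS : S.Nonempty) :
    ∑ z ∈ S, Polynomial.C (partialFractionCoeff S z) *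
      ∏ z' ∈ S.erase z, (Polynomial.X - Polynomial.C z') = Polynomial.X ^ (S.card - 1) := by
  have h := Lagrange.eq_interpolate (s := S) (v := id) (f := (Polynomial.X : Polynomial ℂ) ^
    (S.card - 1)) Function.injective_id.injOn (by
      rw [Polynomial.degree_X_pow]
      have := hS.card_pos
      exact_mod_cast (by omega : S.card - 1 < S.card))
  rw [h, Lagrange.interpolate_apply]
  refine Finset.sum_congr rfl fun z hz => ?_
  simp only [Polynomial.eval_pow, Polynomial.eval_X, id, Lagrange.basis, Lagrange.basisDivisor,
    Finset.prod_mul_distrib, partialFractionCoeff]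
  rw [← mul_assoc, ← map_prod, ← Polynomial.C_mul]
  congr 2
  rw [← Finset.card_erase_of_mem hz, ← Finset.prod_const, ← Finset.prod_mul_distrib]
  simp [div_eq_mul_inv]

/-- The shift on two-sided sequences. -/
def shift : Module.End ℂ (ℤ → ℂ) where
  toFun y t := y (t + 1)
  map_add' _ _ := rfl
  map_smul' _ _ := rfl

theorem shift_pow_apply (m : ℕ) (y : ℤ → ℂ) (t : ℤ) : (shift ^ m) y t = y (t + m) := by
  induction m generalizing t with
  | zero => simp
  | succ m ih =>
    rw [pow_succ', Module.End.mul_apply]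
    change (shift ^ m) y (t + 1) = _
    rw [ih]; congr 1; push_cast; ring

theorem aeval_shift_apply (q : Polynomial ℂ) (y : ℤ → ℂ) (t : ℤ) :
    Polynomial.aeval shift q y t =
      ∑ m ∈ Finset.range (q.natDegree + 1), q.coeff m * y (t + m) := by
  rw [Polynomial.aeval_eq_sum_range, LinearMap.sum_apply, Finset.sum_apply]
  simp [shift_pow_apply]

/-- The recursion read at time t + p, so that only forward shifts occur and polynomial algebra
applies. -/
theorem aeval_shift_charPoly (a : Fin p → ℝ) {y e : ℤ → ℝ}
    (h : ∀ t, y t = ∑ i : Fin p, a i * y (t - ((i : ℤ) + 1)) + e t) (t : ℤ) :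
    Polynomial.aeval shift (charPoly a) (fun s => (y s : ℂ)) t = e (t + p) := by
  have h' := h (t + p)
  rw [charPoly, map_sub, map_sum, map_pow, Polynomial.aeval_X]
  simp only [map_mul, map_pow, Polynomial.aeval_X, Polynomial.aeval_C, LinearMap.sub_apply,
    LinearMap.sum_apply, Pi.sub_apply, Finset.sum_apply, Module.End.mul_apply,
    Module.algebraMap_end_apply, Pi.smul_apply, shift_pow_apply, smul_eq_mul]
  have hs : ∑ i : Fin p, (a i : ℂ) * (y (t + (p - 1 - (i : ℕ) : ℕ)) : ℂ) =
      ∑ i : Fin p, (a i : ℂ) * (y (t + p - ((i : ℤ) + 1)) : ℂ) := by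
    refine Finset.sum_congr rfl fun i _ => ?_
    congr 3
    have := i.2
    push_cast [Nat.sub_sub, Nat.cast_sub (show 1 + (i : ℕ) ≤ p by omega)]
    ring
  rw [h', hs]
  push_cast
  ring

/-- The impulse response of the autoregression. -/
def impulseResponse (a : Fin p → ℝ) (h : ℕ) : ℝ :=
  (∑ z ∈ rootSet a, partialFractionCoeff (rootSet a) z * z ^ h).re

/-- A solution of the autoregression is, up to an exponentially small multiple of its past, a
finite moving average of the innovations. -/
theorem exists_movingAverage_remainder (hp : 1 ≤ p) (a : Fin p → ℝ)
    (hd : (charPoly a).roots.Nodup) :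
    ∃ κ : ℕ → ℝ, (∀ m, 0 ≤ κ m) ∧ ∀ (l : ℝ), (∀ z ∈ rootSet a, ‖z‖ ≤ l) →
      ∀ y e : ℤ → ℝ, (∀ t, y t = ∑ i : Fin p, a i * y (t - ((i : ℤ) + 1)) + e t) →
      ∀ (H : ℕ) (t : ℤ),
        |∑ h ∈ Finset.range H, impulseResponse a h * e (t - h) - y t| ≤
          l ^ H * ∑ m ∈ Finset.range p, κ m * |y (t - (p - 1) - H + m)| := by
  set S := rootSet a with hS
  have hcard : S.card = p := card_rootSet a hd
  set q : ℂ → Polynomial ℂ := fun z => ∏ z' ∈ S.erase z, (Polynomial.X - Polynomial.C z') with hq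
  have hqdeg : ∀ z ∈ S, (q z).natDegree + 1 = p := by
    intro z hz
    rw [hq, Polynomial.natDegree_prod_of_monic _ _ fun z _ => Polynomial.monic_X_sub_C z]
    simp [Finset.card_erase_of_mem hz]
    omega
  refine ⟨fun m => ∑ z ∈ S, ‖partialFractionCoeff S z‖ * ‖(q z).coeff m‖,
    fun m => Finset.sum_nonneg fun z _ => by positivity, ?_⟩
  intro l hl y e hy H t
  have hSne : S.Nonempty := by rw [← Finset.card_pos]; omega
  set yc : ℤ → ℂ := fun s => (y s : ℂ) with hyc
  -- Removing all factors except the one at z leaves a first-order recursion for `w z`, which can be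
  -- unrolled explicitly.
  set w : ℂ → ℤ → ℂ := fun z => Polynomial.aeval shift (q z) yc with hw
  have hstep : ∀ z ∈ S, ∀ s, w z (s + 1) = z * w z s + e (s + p) := by
    intro z hz s
    have h1 : charPoly a = (Polynomial.X - Polynomial.C z) * q z := by
      rw [charPoly_eq_prod a hd, ← Finset.mul_prod_erase _ _ hz]
    have h2 := aeval_shift_charPoly a hy s
    rw [h1, map_mul, Module.End.mul_apply, map_sub, Polynomial.aeval_X, Polynomial.aeval_C] at h2
    rw [← h2]
    simp only [LinearMap.sub_apply, Pi.sub_apply, Module.algebraMap_end_apply, Pi.smul_apply,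
      smul_eq_mul]
    change w z (s + 1) = z * w z s + (w z (s + 1) - z * w z s)
    ring
  have hunroll : ∀ z ∈ S, ∀ H : ℕ, ∀ s : ℤ,
      w z s = ∑ h ∈ Finset.range H, z ^ h * e (s + (p - 1) - h) + z ^ H * w z (s - H) := by
    intro z hz H s
    induction H with
    | zero => simp
    | succ H ih =>
      have := hstep z hz (s - ((H + 1 : ℕ) : ℤ))
      rw [ih, Finset.sum_range_succ, show s - (H : ℤ) = s - ((H + 1 : ℕ) : ℤ) + 1 by push_cast; ring,
        this, show s - ((H + 1 : ℕ) : ℤ) + p = s + (p - 1) - H by push_cast; ring]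
      ring
  -- The partial fraction identity, evaluated at the shift, recombines the first-order sequences
  -- into `y`.
  have hrec : ∀ s, (y (s + (p - 1)) : ℂ) = ∑ z ∈ S, partialFractionCoeff S z * w z s := by
    intro s
    have h1 := congrArg (fun P => Polynomial.aeval shift P yc s)
      (sum_partialFractionCoeff_mul S hSne)
    simp only [map_sum, map_mul, Polynomial.aeval_C, map_pow, Polynomial.aeval_X, shift_pow_apply,
      LinearMap.sum_apply, Finset.sum_apply, Module.End.mul_apply, Module.algebraMap_end_apply,
      Pi.smul_apply, smul_eq_mul, hcard] at h1
    rw [Nat.cast_sub hp] at h1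
    rw [hyc] at h1
    rw [hw, hyc]
    simp only [hq] at h1 ⊢
    rw [h1]; norm_num
  set s := t - (p - 1) with hs
  have ht : (y t : ℂ) = ∑ h ∈ Finset.range H,
      (∑ z ∈ S, partialFractionCoeff S z * z ^ h) * e (t - h) +
        ∑ z ∈ S, partialFractionCoeff S z * (z ^ H * w z (s - H)) := by
    have h1 := hrec s
    rw [show s + ((p : ℤ) - 1) = t by rw [hs]; ring] at h1
    rw [h1]
    have : ∀ z ∈ S, partialFractionCoeff S z * w z s =
        ∑ h ∈ Finset.range H, partialFractionCoeff S z * z ^ h * e (t - h) +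
          partialFractionCoeff S z * (z ^ H * w z (s - H)) := by
      intro z hz
      rw [hunroll z hz H s, mul_add, Finset.mul_sum]
      congr 1
      refine Finset.sum_congr rfl fun h _ => ?_
      rw [show s + ((p : ℤ) - 1) - h = t - h by rw [hs]; ring]
      ring
    rw [Finset.sum_congr rfl this, Finset.sum_add_distrib, Finset.sum_comm]
    simp only [Finset.sum_mul]
  have hre := congrArg Complex.re ht
  rw [Complex.ofReal_re, Complex.add_re, Complex.re_sum] at hre
  simp only [Complex.re_mul_ofReal] at hre
  rw [hre]
  simp only [impulseResponse, ← hS]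
  rw [sub_add_cancel_left, abs_neg]
  refine (Complex.abs_re_le_norm _).trans ?_
  refine (norm_sum_le _ _).trans ?_
  have hz : ∀ z ∈ S, ‖partialFractionCoeff S z * (z ^ H * w z (s - H))‖ ≤
      l ^ H * ∑ m ∈ Finset.range p, ‖partialFractionCoeff S z‖ * ‖(q z).coeff m‖ *
        |y (s - H + m)| := by
    intro z hz
    have hw' : ‖w z (s - H)‖ ≤ ∑ m ∈ Finset.range p, ‖(q z).coeff m‖ * |y (s - H + m)| := by
      rw [hw]
      simp only
      rw [aeval_shift_apply, hqdeg z hz]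
      refine (norm_sum_le _ _).trans (Finset.sum_le_sum fun m _ => ?_)
      rw [norm_mul, hyc, Complex.norm_real, Real.norm_eq_abs]
    have hzl := hl z hz
    have hl0 : 0 ≤ l := (norm_nonneg z).trans hzl
    calc _ = ‖partialFractionCoeff S z‖ * (‖z‖ ^ H * ‖w z (s - H)‖) := by
          rw [norm_mul, norm_mul, norm_pow]
      _ ≤ ‖partialFractionCoeff S z‖ * (l ^ H *
            ∑ m ∈ Finset.range p, ‖(q z).coeff m‖ * |y (s - H + m)|) := by
          gcongr
      _ = _ := by
          simp only [mul_assoc, ← Finset.mul_sum]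
          ring
  refine (Finset.sum_le_sum hz).trans_eq ?_
  rw [← Finset.mul_sum, Finset.sum_comm]
  simp only [Finset.sum_mul]

theorem lambdaStar_lt_one {N : ℕ} {p : Fin N → ℕ} (α : ∀ n, Fin (p n) → ℝ)
    (h : ∀ n, ∀ z ∈ (charPoly (α n)).roots, ‖z‖ < 1) : lambdaStar α < 1 := by
  rw [lambdaStar, Finset.sup_lt_iff (by simp)]
  intro n _
  rw [Finset.sup_lt_iff (by simp)]
  intro z hz
  have := h n z (by simpa [rootSet] using hz)
  exact_mod_cast this

theorem norm_le_lambdaStar {N : ℕ} {p : Fin N → ℕ} (α : ∀ n, Fin (p n) → ℝ) (n : Fin N) {z : ℂ}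
    (hz : z ∈ rootSet (α n)) : ‖z‖ ≤ lambdaStar α := by
  have h1 : ‖z‖₊ ≤ (rootSet (α n)).sup fun z => ‖z‖₊ := Finset.le_sup (f := fun z : ℂ => ‖z‖₊) hz
  have h2 : ((rootSet (α n)).sup fun z => ‖z‖₊) ≤ lambdaStar α :=
    Finset.le_sup (f := fun n => (rootSet (α n)).sup fun z => ‖z‖₊) (Finset.mem_univ n)
  exact_mod_cast h1.trans h2

/-- The triangle inequality over the roots; this is the origin of c_λ and of the geometric decay
behind σ_x. -/
theorem abs_impulseResponse_le {N : ℕ} {p : Fin N → ℕ} (α : ∀ n, Fin (p n) → ℝ) (n : Fin N)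
    (h : ℕ) : |impulseResponse (α n) h| ≤ cLambda α * lambdaStar α ^ h := by
  have hc : (∑ z ∈ rootSet (α n), ‖partialFractionCoeff (rootSet (α n)) z‖₊) ≤ cLambda α :=
    Finset.le_sup (f := fun n => ∑ z ∈ rootSet (α n),
      ‖∏ z' ∈ (rootSet (α n)).erase z, z / (z - z')‖₊) (Finset.mem_univ n)
  have hc' : ∑ z ∈ rootSet (α n), ‖partialFractionCoeff (rootSet (α n)) z‖ ≤ cLambda α := by
    have := NNReal.coe_le_coe.2 hc
    rw [NNReal.coe_sum] at this
    simpa only [coe_nnnorm] using this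
  calc _ ≤ ‖∑ z ∈ rootSet (α n), partialFractionCoeff (rootSet (α n)) z * z ^ h‖ :=
        Complex.abs_re_le_norm _
    _ ≤ ∑ z ∈ rootSet (α n), ‖partialFractionCoeff (rootSet (α n)) z‖ * lambdaStar α ^ h := by
        refine (norm_sum_le _ _).trans (Finset.sum_le_sum fun z hz => ?_)
        rw [norm_mul, norm_pow]
        have := norm_le_lambdaStar α n hz
        gcongr
    _ ≤ _ := by
        rw [← Finset.sum_mul]
        gcongr

end Autoregression

/-! ### Sums, limits and tails of sub-gaussian variables. -/

section SubgaussianLimits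

variable {Ω : Type u} [MeasurableSpace Ω] {μ : Measure Ω}

theorem _root_.ProbabilityTheory.HasSubgaussianMGF.mono {X : Ω → ℝ} {c d : ℝ≥0}
    (h : HasSubgaussianMGF X c μ) (hcd : c ≤ d) : HasSubgaussianMGF X d μ where
  integrable_exp_mul := h.integrable_exp_mul
  mgf_le t := (h.mgf_le t).trans (by gcongr)

/-- Without independence the square roots of the proxies add. It is applied to different lags, which
share innovations. -/
theorem hasSubgaussianMGF_sum_range [IsProbabilityMeasure μ] {X : ℕ → Ω → ℝ} {b : ℕ → ℝ≥0}
    (h : ∀ i, HasSubgaussianMGF (X i) (b i ^ 2) μ) (H : ℕ) :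
    HasSubgaussianMGF (fun ω => ∑ i ∈ Finset.range H, X i ω) ((∑ i ∈ Finset.range H, b i) ^ 2)
      μ := by
  induction H with
  | zero => simp
  | succ H ih => simpa [Finset.sum_range_succ] using ih.add (h H)

/-- Sub-gaussianity passes to limits in `L¹`. -/
theorem hasSubgaussianMGF_of_tendsto [IsProbabilityMeasure μ] {X : ℕ → Ω → ℝ} {Y : Ω → ℝ} {c : ℝ≥0}
    (h : ∀ i, HasSubgaussianMGF (X i) c μ) (hY : AEStronglyMeasurable Y μ)
    (hlim : Tendsto (fun i => eLpNorm (X i - Y) 1 μ) atTop (𝓝 0)) : HasSubgaussianMGF Y c μ := by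
  obtain ⟨ns, -, hns⟩ := (tendstoInMeasure_of_tendsto_eLpNorm one_ne_zero
    (fun i => (h i).aestronglyMeasurable) hY hlim).exists_seq_tendsto_ae
  have hmeas : ∀ t : ℝ, AEStronglyMeasurable (fun ω => Real.exp (t * Y ω)) μ := fun t =>
    Real.continuous_exp.comp_aestronglyMeasurable (hY.const_mul t)
  have hint : ∀ (t : ℝ) (i : ℕ), ∫⁻ ω, ENNReal.ofReal (Real.exp (t * X i ω)) ∂μ ≤
      ENNReal.ofReal (Real.exp (c * t ^ 2 / 2)) := by
    intro t i
    rw [← ofReal_integral_eq_lintegral_ofReal ((h i).integrable_exp_mul t)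
      (Eventually.of_forall fun ω => (Real.exp_pos _).le)]
    exact ENNReal.ofReal_le_ofReal ((h i).mgf_le t)
  -- Fatou's lemma along an almost surely convergent subsequence; working with lower integrals
  -- yields integrability as well.
  have hlint : ∀ t : ℝ, ∫⁻ ω, ENNReal.ofReal (Real.exp (t * Y ω)) ∂μ ≤
      ENNReal.ofReal (Real.exp (c * t ^ 2 / 2)) := by
    intro t
    have e : ∫⁻ ω, ENNReal.ofReal (Real.exp (t * Y ω)) ∂μ =
        ∫⁻ ω, liminf (fun i => ENNReal.ofReal (Real.exp (t * X (ns i) ω))) atTop ∂μ := by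
      refine lintegral_congr_ae ?_
      filter_upwards [hns] with ω hω
      refine (Tendsto.liminf_eq ?_).symm
      exact (ENNReal.continuous_ofReal.tendsto _).comp
        ((Real.continuous_exp.tendsto _).comp (hω.const_mul t))
    rw [e]
    refine (lintegral_liminf_le' fun i => ?_).trans ?_
    · exact ((h (ns i)).integrable_exp_mul t).1.aemeasurable.ennreal_ofReal
    · exact liminf_le_of_le (by isBoundedDefault)
        fun b hb => (hb.exists.choose_spec).trans (hint t _)
  have hI : ∀ t : ℝ, Integrable (fun ω => Real.exp (t * Y ω)) μ := by
    intro t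
    refine ⟨hmeas t, ?_⟩
    rw [hasFiniteIntegral_iff_ofReal (Eventually.of_forall fun ω => (Real.exp_pos _).le)]
    exact (hlint t).trans_lt ENNReal.ofReal_lt_top
  refine ⟨hI, fun t => ?_⟩
  have h1 := hlint t
  rw [← ofReal_integral_eq_lintegral_ofReal (hI t)
    (Eventually.of_forall fun ω => (Real.exp_pos _).le)] at h1
  exact (ENNReal.ofReal_le_ofReal_iff (Real.exp_pos _).le).1 h1

/-- Two-sided tail bound, valid also for variance proxy zero. -/
theorem measure_abs_gt_le [IsProbabilityMeasure μ] {X : Ω → ℝ} {s : ℝ≥0}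
    (h : HasSubgaussianMGF X (s ^ 2) μ) {τ : ℝ} (hτ : 0 ≤ τ) :
    μ {ω | s * τ < |X ω|} ≤ ENNReal.ofReal (2 * Real.exp (-τ ^ 2 / 2)) := by
  -- With proxy zero the variable vanishes almost surely; the strict inequality in the event makes
  -- it null.
  rcases eq_or_ne s 0 with rfl | hs
  · have h0 := HasSubgaussianMGF.ae_eq_zero_of_hasSubgaussianMGF_zero (μ := μ) (X := X)
      (by simpa using h)
    have : μ {ω | ((0 : ℝ≥0) : ℝ) * τ < |X ω|} = 0 := by
      refine measure_mono_null (t := {ω | ¬ X ω = (0 : Ω → ℝ) ω}) ?_ h0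
      intro ω hω h'
      simp [h'] at hω
    rw [this]; exact zero_le
  have hs' : (0 : ℝ) < s := by positivity
  have key : ∀ Z : Ω → ℝ, HasSubgaussianMGF Z (s ^ 2) μ →
      μ {ω | s * τ ≤ Z ω} ≤ ENNReal.ofReal (Real.exp (-τ ^ 2 / 2)) := by
    intro Z hZ
    have h1 := hZ.measure_ge_le (ε := s * τ) (by positivity)
    have e : -((s : ℝ) * τ) ^ 2 / (2 * ((s ^ 2 : ℝ≥0) : ℝ)) = -τ ^ 2 / 2 := by
      push_cast; field_simp
    rw [e] at h1
    rw [← ofReal_measureReal]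
    exact ENNReal.ofReal_le_ofReal h1
  calc _ ≤ μ ({ω | s * τ ≤ X ω} ∪ {ω | s * τ ≤ (-X) ω}) := by
        refine measure_mono fun ω hω => ?_
        rcases lt_abs.1 (show s * τ < |X ω| from hω) with h1 | h1
        · exact Or.inl h1.le
        · exact Or.inr h1.le
    _ ≤ _ := measure_union_le _ _
    _ ≤ ENNReal.ofReal (Real.exp (-τ ^ 2 / 2)) + ENNReal.ofReal (Real.exp (-τ ^ 2 / 2)) :=
        add_le_add (key _ h) (key _ h.neg)
    _ = _ := by
        rw [← ENNReal.ofReal_add (by positivity) (by positivity)]; congr 1; ring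

end SubgaussianLimits

/-! ### Sub-gaussianity of linear combinations of the autoregressive noise. -/

section Noise

variable {Ω : Type u} [MeasurableSpace Ω] {μ : Measure Ω} [IsProbabilityMeasure μ] {N : ℕ}
  {p : Fin N → ℕ} {α : ∀ n, Fin (p n) → ℝ} {η x : Fin N → ℤ → Ω → ℝ} {σ : ℝ≥0}

/-- Constant mean and variance control the first absolute moment uniformly in time, so the far past
in the moving average remainder cannot outgrow the geometric factor. -/
theorem IsStationary.exists_lintegral_le {x : ℤ → Ω → ℝ} (h : IsStationary μ x) :
    ∃ M : ℝ, ∀ t, ∫⁻ ω, ENNReal.ofReal |x t ω| ∂μ ≤ ENNReal.ofReal M := by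
  obtain ⟨h2, m, -, ρ, hρ⟩ := h
  refine ⟨|m| + 1 + ρ 0, fun t => ?_⟩
  have hL : MemLp (fun ω => x t ω - m) 2 μ := (h2 t).sub (memLp_const m)
  have hsq : Integrable (fun ω => (x t ω - m) ^ 2) μ := hL.integrable_sq
  have hx : Integrable (fun ω => |x t ω|) μ := ((h2 t).integrable (by norm_num)).abs
  rw [← ofReal_integral_eq_lintegral_ofReal hx (Eventually.of_forall fun ω => abs_nonneg _)]
  refine ENNReal.ofReal_le_ofReal ?_
  have hρ' := hρ t 0
  calc ∫ ω, |x t ω| ∂μ ≤ ∫ ω, ((|m| + 1) + (x t ω - m) ^ 2) ∂μ := by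
        refine integral_mono hx ((integrable_const _).add hsq) fun ω => ?_
        have h1 : |x t ω| ≤ |x t ω - m| + |m| := by
          simpa using abs_add_le (x t ω - m) m
        have h2 : |x t ω - m| ≤ 1 + (x t ω - m) ^ 2 := by
          rw [← sq_abs]
          nlinarith [sq_nonneg (|x t ω - m| - 1), abs_nonneg (x t ω - m)]
        simp only
        linarith
    _ = |m| + 1 + ρ 0 := by
        rw [integral_add (integrable_const _) hsq, ← hρ']
        simp [sq]

/-- The noise is the `L¹` limit of moving averages of the innovations. -/
theorem tendsto_eLpNorm_movingAverage (hp : ∀ n, 1 ≤ p n) (hx : StationaryAR μ α η x)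
    (n : Fin N) (t : ℤ) :
    Tendsto (fun H : ℕ => eLpNorm (fun ω => ∑ h ∈ Finset.range H,
      impulseResponse (α n) h * η n (t - h) ω - x n t ω) 1 μ) atTop (𝓝 0) := by
  obtain ⟨κ, hκ0, hκ⟩ := exists_movingAverage_remainder (hp n) (α n) (hx.distinct_roots n)
  obtain ⟨M, hM⟩ := (hx.stationary n).exists_lintegral_le
  have hrec : ∀ᵐ ω ∂μ, ∀ t, x n t ω =
      ∑ i : Fin (p n), α n i * x n (t - ((i : ℤ) + 1)) ω + η n t ω :=
    ae_all_iff.2 (hx.recursion n)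
  set l : ℝ := ((lambdaStar α : ℝ≥0) : ℝ) with hl
  have hl1 : l < 1 := by exact_mod_cast lambdaStar_lt_one α hx.norm_root_lt_one
  have hl0 : 0 ≤ l := NNReal.coe_nonneg _
  have hbound : ∀ H : ℕ, eLpNorm (fun ω => ∑ h ∈ Finset.range H,
      impulseResponse (α n) h * η n (t - h) ω - x n t ω) 1 μ ≤
      ENNReal.ofReal (l ^ H) * ∑ m ∈ Finset.range (p n), ENNReal.ofReal (κ m) *
        ENNReal.ofReal M := by
    intro H
    rw [eLpNorm_one_eq_lintegral_enorm]
    have hmeas : ∀ s, AEMeasurable (fun ω => ENNReal.ofReal |x n s ω|) μ := fun s =>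
      ((hx.stationary n).1 s).1.aemeasurable.abs.ennreal_ofReal
    calc _ ≤ ∫⁻ ω, ENNReal.ofReal (l ^ H) * ∑ m ∈ Finset.range (p n), ENNReal.ofReal (κ m) *
          ENNReal.ofReal |x n (t - (p n - 1) - H + m) ω| ∂μ := by
          refine lintegral_mono_ae ?_
          filter_upwards [hrec] with ω hω
          have := hκ l (fun z hz => norm_le_lambdaStar α n hz) (fun s => x n s ω)
            (fun s => η n s ω) hω H t
          rw [Real.enorm_eq_ofReal_abs]
          refine (ENNReal.ofReal_le_ofReal this).trans_eq ?_
          rw [ENNReal.ofReal_mul (by positivity), ENNReal.ofReal_sum_of_nonneg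
            fun m _ => mul_nonneg (hκ0 m) (abs_nonneg _)]
          simp only [ENNReal.ofReal_mul (hκ0 _)]
      _ = ENNReal.ofReal (l ^ H) * ∑ m ∈ Finset.range (p n), ENNReal.ofReal (κ m) *
          ∫⁻ ω, ENNReal.ofReal |x n (t - (p n - 1) - H + m) ω| ∂μ := by
          rw [lintegral_const_mul' _ _ ENNReal.ofReal_ne_top, lintegral_finsetSum' _
            fun m _ => (hmeas _).const_mul _]
          simp only [lintegral_const_mul' _ _ ENNReal.ofReal_ne_top]
      _ ≤ _ := by
          gcongr
          exact hM _
  refine tendsto_of_tendsto_of_tendsto_of_le_of_le tendsto_const_nhds ?_ (fun _ => zero_le) hbound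
  have h1 : Tendsto (fun H : ℕ => ENNReal.ofReal (l ^ H)) atTop (𝓝 0) := by
    have := ENNReal.continuous_ofReal.tendsto 0 |>.comp
      (tendsto_pow_atTop_nhds_zero_of_lt_one hl0 hl1)
    simpa [Function.comp_def] using this
  have h2 := ENNReal.Tendsto.mul_const (b := ∑ m ∈ Finset.range (p n), ENNReal.ofReal (κ m) *
        ENNReal.ofReal M) h1 (Or.inr (ENNReal.sum_ne_top.2 fun m _ =>
          ENNReal.mul_ne_top ENNReal.ofReal_ne_top ENNReal.ofReal_ne_top))
  simpa using h2

/-- `σ_x` as a nonnegative real number. -/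
def sigmaXNN (α : ∀ n, Fin (p n) → ℝ) (σ : ℝ≥0) : ℝ≥0 := cLambda α * σ / (1 - lambdaStar α)

theorem coe_sigmaXNN (h : lambdaStar α ≤ 1) : (sigmaXNN α σ : ℝ) = sigmaX α σ := by
  rw [sigmaXNN, sigmaX]
  push_cast [NNReal.coe_sub h]
  rfl

/-- Every linear combination of finitely many noise variables is sub-gaussian. -/
theorem hasSubgaussianMGF_noise (hp : ∀ n, 1 ≤ p n) (hx : StationaryAR μ α η x)
    (hη : SubgaussianNoise μ η σ) {ι : Type*} [Fintype ι] (q : ι → Fin N × ℤ)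
    (hq : Function.Injective q) (c : ι → ℝ) :
    HasSubgaussianMGF (fun ω => ∑ i, c i * x (q i).1 (q i).2 ω)
      ((sigmaXNN α σ * NNReal.sqrt (∑ i, ‖c i‖₊ ^ 2)) ^ 2) μ := by
  set ψ : Fin N → ℕ → ℝ := fun n => impulseResponse (α n) with hψ
  have hl1 : lambdaStar α < 1 := lambdaStar_lt_one α hx.norm_root_lt_one
  set A : ℝ≥0 := ∑ i, ‖c i‖₊ ^ 2 with hA
  -- At a fixed lag, distinct index pairs stay distinct, so the innovations are independent and the
  -- proxies themselves add.
  have hinner : ∀ h : ℕ, HasSubgaussianMGF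
      (fun ω => ∑ i, (c i * ψ (q i).1 h) * η (q i).1 ((q i).2 - h) ω)
      ((cLambda α * lambdaStar α ^ h * σ * NNReal.sqrt A) ^ 2) μ := by
    intro h
    have hinj : Function.Injective fun i => ((q i).1, (q i).2 - (h : ℤ)) := by
      intro i j hij
      simp only [Prod.mk.injEq, sub_left_inj] at hij
      exact hq (Prod.ext hij.1 hij.2)
    have hind : iIndepFun (fun i ω => (c i * ψ (q i).1 h) * η (q i).1 ((q i).2 - h) ω) μ :=
      (hη.indep.precomp hinj).comp (fun i y => (c i * ψ (q i).1 h) * y)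
        fun i => measurable_const_mul _
    have h1 := HasSubgaussianMGF.sum_of_iIndepFun hind (s := Finset.univ)
      (c := fun i => ‖c i * ψ (q i).1 h‖₊ ^ 2 * σ ^ 2) fun i _ => by
        have h2 := (hη.subgaussian (q i).1 ((q i).2 - h)).const_mul (c i * ψ (q i).1 h)
        convert h2 using 2
        ext
        rw [NNReal.coe_mul]
        change _ = (c i * ψ (q i).1 h) ^ 2 * _
        simp [mul_pow]
    refine h1.mono ?_
    calc _ ≤ ∑ i, ‖c i‖₊ ^ 2 * ((cLambda α * lambdaStar α ^ h) ^ 2 * σ ^ 2) := by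
          refine Finset.sum_le_sum fun i _ => ?_
          have h3 : ‖ψ (q i).1 h‖₊ ≤ cLambda α * lambdaStar α ^ h := by
            have := abs_impulseResponse_le α (q i).1 h
            rw [← NNReal.coe_le_coe]
            simpa using this
          rw [nnnorm_mul, mul_pow, mul_assoc]
          gcongr
      _ = _ := by
          rw [← Finset.sum_mul, ← hA, mul_pow _ (NNReal.sqrt A), NNReal.sq_sqrt]
          ring
  have hsum : ∀ H : ℕ, HasSubgaussianMGF (fun ω => ∑ h ∈ Finset.range H,
      ∑ i, (c i * ψ (q i).1 h) * η (q i).1 ((q i).2 - h) ω)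
      ((sigmaXNN α σ * NNReal.sqrt A) ^ 2) μ := by
    -- Across lags only the parameters add, and the geometric series produces the factor 1 / (1 −
    -- λ_⋆).
    intro H
    refine (hasSubgaussianMGF_sum_range hinner H).mono ?_
    gcongr
    rw [← Finset.sum_mul]
    gcongr
    have hgeom : ∑ h ∈ Finset.range H, lambdaStar α ^ h ≤ (1 - lambdaStar α)⁻¹ := by
      rw [← NNReal.tsum_geometric hl1]
      exact (NNReal.summable_geometric hl1).sum_le_tsum _ fun _ _ => zero_le
    calc ∑ h ∈ Finset.range H, cLambda α * lambdaStar α ^ h * σ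
        = cLambda α * σ * ∑ h ∈ Finset.range H, lambdaStar α ^ h := by
          rw [Finset.mul_sum]; exact Finset.sum_congr rfl fun _ _ => by ring
      _ ≤ cLambda α * σ * (1 - lambdaStar α)⁻¹ := by gcongr
      _ = _ := by rw [sigmaXNN, div_eq_mul_inv]
  have hxm : ∀ n t, AEStronglyMeasurable (x n t) μ := fun n t => ((hx.stationary n).1 t).1
  have hηm : ∀ n t, AEStronglyMeasurable (η n t) μ := fun n t =>
    (hη.subgaussian n t).aestronglyMeasurable
  refine hasSubgaussianMGF_of_tendsto hsum ?_ ?_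
  · exact Finset.aestronglyMeasurable_fun_sum _ fun i _ => (hxm _ _).const_mul _
  · have hle : ∀ H : ℕ, eLpNorm ((fun ω => ∑ h ∈ Finset.range H,
        ∑ i, (c i * ψ (q i).1 h) * η (q i).1 ((q i).2 - h) ω) -
          fun ω => ∑ i, c i * x (q i).1 (q i).2 ω) 1 μ ≤
        ∑ i, ‖c i‖ₑ * eLpNorm (fun ω => ∑ h ∈ Finset.range H,
          ψ (q i).1 h * η (q i).1 ((q i).2 - h) ω - x (q i).1 (q i).2 ω) 1 μ := by
      intro H
      have e : ((fun ω => ∑ h ∈ Finset.range H,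
          ∑ i, (c i * ψ (q i).1 h) * η (q i).1 ((q i).2 - h) ω) -
            fun ω => ∑ i, c i * x (q i).1 (q i).2 ω) =
          ∑ i, (c i • fun ω => ∑ h ∈ Finset.range H,
            ψ (q i).1 h * η (q i).1 ((q i).2 - h) ω - x (q i).1 (q i).2 ω) := by
        ext ω
        simp only [Pi.sub_apply, Finset.sum_apply, Pi.smul_apply, smul_eq_mul, mul_sub,
          Finset.sum_sub_distrib, Finset.mul_sum]
        rw [Finset.sum_comm]
        simp only [mul_assoc]
      rw [e]
      refine (eLpNorm_sum_le (fun i _ => ?_) le_rfl).trans_eq ?_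
      · refine AEStronglyMeasurable.const_smul (AEStronglyMeasurable.sub ?_ (hxm _ _)) _
        exact Finset.aestronglyMeasurable_fun_sum _ fun h _ => (hηm _ _).const_mul _
      · simp only [eLpNorm_const_smul]
    refine tendsto_of_tendsto_of_tendsto_of_le_of_le tendsto_const_nhds ?_ (fun _ => zero_le) hle
    have h0 : Tendsto (fun H : ℕ => ∑ i, ‖c i‖ₑ * eLpNorm (fun ω => ∑ h ∈ Finset.range H,
          ψ (q i).1 h * η (q i).1 ((q i).2 - h) ω - x (q i).1 (q i).2 ω) 1 μ) atTop
        (𝓝 (∑ i, ‖c i‖ₑ * 0)) := by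
      refine tendsto_finsetSum _ fun i _ => ?_
      exact ENNReal.Tendsto.const_mul (tendsto_eLpNorm_movingAverage hp hx _ _)
        (Or.inr enorm_ne_top)
    simpa using h0

end Noise

/-! ### Rank of the stacked Page matrix. -/

section Rank

variable {m n ι : Type*} [Fintype n] [Finite m]

theorem rank_add_le (A B : Matrix m n ℝ) : (A + B).rank ≤ A.rank + B.rank := by
  have := Fintype.ofFinite m
  rw [Matrix.rank, Matrix.rank, Matrix.rank, Matrix.mulVecLin_add]
  have h : (A.mulVecLin + B.mulVecLin).range ≤ A.mulVecLin.range ⊔ B.mulVecLin.range := by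
    rintro _ ⟨v, rfl⟩
    exact Submodule.add_mem_sup (LinearMap.mem_range_self _ _) (LinearMap.mem_range_self _ _)
  exact (Submodule.finrank_mono h).trans (Submodule.finrank_add_le_finrank_add_finrank _ _)

theorem rank_sum_le (s : Finset ι) (A : ι → Matrix m n ℝ) :
    (∑ i ∈ s, A i).rank ≤ ∑ i ∈ s, (A i).rank := by
  classical
  induction s using Finset.induction_on with
  | empty => simp
  | insert i s hi ih =>
    rw [Finset.sum_insert hi, Finset.sum_insert hi]
    exact (rank_add_le _ _).trans (by gcongr)

theorem rank_eq_finrank_range_toEuclideanLin [DecidableEq n] (A : Matrix m n ℝ) :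
    A.rank = finrank ℝ (Matrix.toEuclideanLin A).range := by
  have := Fintype.ofFinite m
  exact A.rank_eq_finrank_range_toLin (PiLp.basisFun 2 ℝ m) (PiLp.basisFun 2 ℝ n)

/-- The stacked Page matrix of combinations of `R` series whose Page matrices have rank at most
`G` has rank at most `G * R`. -/
theorem rank_stackedPage_le {N R G : ℕ} {f : Fin N → ℕ → ℝ} {coef : Fin N → Fin R → ℝ}
    {w : Fin R → ℕ → ℝ} (hf : SpatialStructure f coef w) (hw : TemporalStructure w G)
    {L T t₀ : ℕ} (hT : 1 < T) (hL : 1 ≤ L) (hLT : L ≤ T) (ht : 1 ≤ t₀) :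
    (stackedPage f L T t₀).rank ≤ G * R := by
  -- `D r` is a row of scalar blocks, one multiple of the identity per series; multiplying by it on
  -- the right spreads the Page matrix of `w r` without raising its rank.
  let D : Fin R → Matrix (Fin (T / L)) (Fin N × Fin (T / L)) ℝ :=
    fun r j c => if j = c.2 then coef c.1 r else 0
  have h : stackedPage f L T t₀ = ∑ r, pageMatrix (w r) L T t₀ * D r := by
    ext i c
    rw [Matrix.sum_apply, stackedPage, pageMatrix, hf _ _ (by omega)]
    refine Finset.sum_congr rfl fun r _ => ?_
    rw [Matrix.mul_apply]
    simp [D, pageMatrix, mul_comm]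
  rw [h]
  refine (rank_sum_le _ _).trans ?_
  calc _ ≤ ∑ _r : Fin R, G := Finset.sum_le_sum fun r _ =>
        (Matrix.rank_mul_le_left _ _).trans (hw r T L t₀ hT hL hLT ht)
    _ = _ := by simp [mul_comm]

end Rank

/-! ### Nets, operator norms and projections. -/

section Nets

variable {E F : Type*} [NormedAddCommGroup E] [InnerProductSpace ℝ E] [FiniteDimensional ℝ E]
  [NormedAddCommGroup F] [InnerProductSpace ℝ F] [FiniteDimensional ℝ F]

omit [InnerProductSpace ℝ E] [FiniteDimensional ℝ E] in
/-- The unit ball has a `1/2`-net of at most `5 ^ dim` points. -/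
theorem exists_half_net [NormedSpace ℝ E] [FiniteDimensional ℝ E] :
    ∃ S : Finset E, S.card ≤ 5 ^ finrank ℝ E ∧ (∀ c ∈ S, ‖c‖ ≤ 1) ∧
      ∀ x : E, ‖x‖ ≤ 1 → ∃ c ∈ S, ‖x - c‖ ≤ 1 / 2 := by
  classical
  let P : Finset E → Prop := fun S =>
    (∀ c ∈ S, ‖c‖ ≤ 1) ∧ ∀ c ∈ S, ∀ d ∈ S, c ≠ d → 1 / 2 ≤ ‖c - d‖
  have hcard : ∀ S, P S → S.card ≤ 5 ^ finrank ℝ E := by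
    intro S hS
    -- Doubling turns 1/2-separated points of the unit ball into 1-separated points of the ball of
    -- radius 2, the normalization of the packing bound.
    have hinj : Function.Injective fun c : E => (2 : ℝ) • c :=
      smul_right_injective E two_ne_zero
    rw [← Finset.card_image_of_injective S hinj]
    apply Besicovitch.card_le_of_separated
    · intro c hc
      obtain ⟨c, hc', rfl⟩ := Finset.mem_image.1 hc
      have := hS.1 c hc'
      rw [norm_smul]; norm_num; linarith
    · intro c hc d hd hcd
      obtain ⟨c, hc', rfl⟩ := Finset.mem_image.1 hc
      obtain ⟨d, hd', rfl⟩ := Finset.mem_image.1 hd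
      have := hS.2 c hc' d hd' (by rintro rfl; exact hcd rfl)
      rw [← smul_sub, norm_smul]; norm_num; linarith
  -- A separated set of maximal cardinality is a net, since an uncovered point could be added to it.
  let Q : ℕ → Prop := fun k => ∃ S, P S ∧ S.card = k
  have hQ0 : Q 0 := ⟨∅, by simp [P], rfl⟩
  obtain ⟨S, hS, hSc⟩ : Q (Nat.findGreatest Q (5 ^ finrank ℝ E)) :=
    Nat.findGreatest_spec (Nat.zero_le _) hQ0
  refine ⟨S, hcard S hS, hS.1, fun x hx => ?_⟩
  by_contra! hcon
  have hxS : x ∉ S := fun h => by have := hcon x h; norm_num at this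
  have hP : P (insert x S) := by
    refine ⟨fun c hc => ?_, fun c hc d hd hcd => ?_⟩
    · rcases Finset.mem_insert.1 hc with rfl | hc
      · exact hx
      · exact hS.1 c hc
    · rcases Finset.mem_insert.1 hc with rfl | hc' <;> rcases Finset.mem_insert.1 hd with rfl | hd'
      · exact absurd rfl hcd
      · exact (hcon d hd').le
      · rw [norm_sub_rev]; exact (hcon c hc').le
      · exact hS.2 c hc' d hd' hcd
  have h1 := Nat.le_findGreatest (P := Q) (hcard _ hP) ⟨_, hP, rfl⟩
  rw [Finset.card_insert_of_notMem hxS] at h1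
  omega

omit [FiniteDimensional ℝ F] in
/-- The operator norm is controlled by the bilinear form on two `1/2`-nets. -/
theorem norm_le_of_half_nets {S : Finset E} {S' : Finset F}
    (hS : ∀ x : E, ‖x‖ ≤ 1 → ∃ c ∈ S, ‖x - c‖ ≤ 1 / 2)
    (hS' : ∀ x : F, ‖x‖ ≤ 1 → ∃ c ∈ S', ‖x - c‖ ≤ 1 / 2) (A : E →ₗ[ℝ] F) {m : ℝ} (hm : 0 ≤ m)
    (h : ∀ b ∈ S, ∀ a ∈ S', |⟪a, A b⟫_ℝ| ≤ m) (b : E) : ‖A b‖ ≤ 4 * m * ‖b‖ := by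
  have h1 : ∀ b ∈ S, ‖A b‖ ≤ 2 * m := by
    intro b hb
    rcases eq_or_ne (A b) 0 with h0 | h0
    · rw [h0, norm_zero]; positivity
    set y := A b
    have hy : 0 < ‖y‖ := norm_pos_iff.2 h0
    obtain ⟨a, ha, hay⟩ := hS' (‖y‖⁻¹ • y) (by rw [norm_smul, norm_inv, norm_norm]; field_simp; rfl)
    have e : ⟪‖y‖⁻¹ • y, y⟫_ℝ = ‖y‖ := by
      rw [real_inner_smul_left, real_inner_self_eq_norm_sq]; field_simp
    have e2 : ⟪‖y‖⁻¹ • y, y⟫_ℝ = ⟪a, y⟫_ℝ + ⟪‖y‖⁻¹ • y - a, y⟫_ℝ := by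
      rw [inner_sub_left]; ring
    have e3 := (le_abs_self _).trans (h b hb a ha)
    have e4 : ⟪‖y‖⁻¹ • y - a, y⟫_ℝ ≤ 1 / 2 * ‖y‖ :=
      (real_inner_le_norm _ _).trans (by gcongr)
    linarith
  let A' : E →L[ℝ] F := LinearMap.toContinuousLinearMap A
  -- The finite operator norm absorbs its own half, a second loss of a factor 2 after the one for
  -- the net of test vectors.
  have h2 : ‖A'‖ ≤ 2 * m + ‖A'‖ * (1 / 2) := by
    refine ContinuousLinearMap.opNorm_le_of_unit_norm (by positivity) fun x hx => ?_
    obtain ⟨c, hc, hxc⟩ := hS x hx.le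
    have : A' x = A c + A' (x - c) := by
      change A x = A c + A (x - c)
      rw [map_sub]; abel
    rw [this]
    exact (norm_add_le _ _).trans (add_le_add (h1 c hc)
      ((A'.le_opNorm _).trans (by gcongr)))
  refine (A'.le_opNorm b).trans ?_
  gcongr
  linarith

/-- The orthogonal projection onto a subspace, in terms of an orthonormal basis of it. -/
theorem norm_sq_starProjection (U : Submodule ℝ F) (z : F) :
    ‖U.starProjection z‖ ^ 2 = ∑ i, ⟪(stdOrthonormalBasis ℝ U i : F), z⟫_ℝ ^ 2 := by
  rw [Submodule.starProjection_apply, ← Submodule.coe_norm,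
    ← (stdOrthonormalBasis ℝ U).sum_sq_norm_inner_right]
  refine Finset.sum_congr rfl fun i _ => ?_
  rw [Submodule.coe_inner, Real.norm_eq_abs, sq_abs, ← Submodule.starProjection_apply,
    ← Submodule.inner_starProjection_left_eq_right, Submodule.starProjection_eq_self_iff.2
      (stdOrthonormalBasis ℝ U i).2]

end Nets

/-! ### The two high-probability events for the noise matrix. -/

section Concentration

variable {Ω : Type u} [MeasurableSpace Ω] {μ : Measure Ω}

theorem measure_exists_le {ι : Type*} (s : Finset ι) (B : ι → Set Ω) {e : ℝ}
    (h : ∀ i ∈ s, μ (B i) ≤ ENNReal.ofReal e) :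
    μ {ω | ∃ i ∈ s, ω ∈ B i} ≤ ENNReal.ofReal (s.card * e) := by
  have : {ω | ∃ i ∈ s, ω ∈ B i} = ⋃ i ∈ s, B i := by ext; simp
  rw [this]
  refine (measure_biUnion_finset_le _ _).trans ((Finset.sum_le_sum h).trans_eq ?_)
  rw [Finset.sum_const, nsmul_eq_mul, ENNReal.ofReal_mul (by positivity)]
  simp

variable [IsProbabilityMeasure μ] {N : ℕ}
  {p : Fin N → ℕ} {α : ∀ n, Fin (p n) → ℝ} {η x : Fin N → ℤ → Ω → ℝ} {σ : ℝ≥0}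

/-- The linear map given by the stacked Page matrix of the noise. -/
def noiseMap (x : Fin N → ℤ → Ω → ℝ) (L T : ℕ) (ω : Ω) :
    EuclideanSpace ℝ (Fin N × Fin (T / L)) →ₗ[ℝ] EuclideanSpace ℝ (Fin L) :=
  Matrix.toEuclideanLin (stackedPage (fun n t => x n (t : ℤ) ω) L T 1)

theorem inner_toEuclideanLin {m n : Type*} [Fintype m] [Fintype n] [DecidableEq n]
    (A : Matrix m n ℝ) (a : EuclideanSpace ℝ m) (b : EuclideanSpace ℝ n) :
    ⟪a, Matrix.toEuclideanLin A b⟫_ℝ = ∑ q : m × n, a q.1 * b q.2 * A q.1 q.2 := by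
  rw [Fintype.sum_prod_type, PiLp.inner_apply]
  refine Finset.sum_congr rfl fun i _ => ?_
  rw [Matrix.toLpLin_apply]
  simp only [Matrix.mulVec, dotProduct, RCLike.inner_apply, conj_trivial, Finset.sum_mul]
  exact Finset.sum_congr rfl fun j _ => by ring

/-- The coefficients form the tensor a ⊗ b of norm ‖a‖‖b‖ ≤ 1. Each noise variable occurs at most
once in a Page matrix, by division with remainder by L. -/
theorem measure_inner_noiseMap_gt_le (hp : ∀ n, 1 ≤ p n) (hx : StationaryAR μ α η x)
    (hη : SubgaussianNoise μ η σ) {L T : ℕ} {a : EuclideanSpace ℝ (Fin L)}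
    {b : EuclideanSpace ℝ (Fin N × Fin (T / L))} (ha : ‖a‖ ≤ 1) (hb : ‖b‖ ≤ 1) {τ : ℝ}
    (hτ : 0 ≤ τ) :
    μ {ω | sigmaX α σ * τ < |⟪a, noiseMap x L T ω b⟫_ℝ|} ≤
      ENNReal.ofReal (2 * Real.exp (-τ ^ 2 / 2)) := by
  let q : Fin L × (Fin N × Fin (T / L)) → Fin N × ℤ :=
    fun c => (c.2.1, ((1 + (c.1 : ℕ) + (c.2.2 : ℕ) * L : ℕ) : ℤ))
  have hq : Function.Injective q := by
    rintro ⟨i, n, j⟩ ⟨i', n', j'⟩ h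
    simp only [q, Prod.mk.injEq, Nat.cast_inj] at h
    obtain ⟨rfl, h⟩ := h
    have h' : (i : ℕ) + j * L = i' + j' * L := by omega
    have hL : 0 < L := i.pos
    have h1 : (i : ℕ) = i' := by
      have := congrArg (· % L) h'
      simpa [Nat.add_mul_mod_self_right, Nat.mod_eq_of_lt i.2, Nat.mod_eq_of_lt i'.2] using this
    have h2 : (j : ℕ) = j' := by
      rw [h1] at h'
      exact Nat.eq_of_mul_eq_mul_right hL (by omega)
    rw [Fin.ext h1, Fin.ext h2]
  have h := hasSubgaussianMGF_noise hp hx hη q hq fun c => a c.1 * b c.2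
  have hle : NNReal.sqrt (∑ c : Fin L × (Fin N × Fin (T / L)), ‖a c.1 * b c.2‖₊ ^ 2) ≤ 1 := by
    rw [NNReal.sqrt_le_one, ← NNReal.coe_le_coe]
    push_cast
    have e : ∑ c : Fin L × (Fin N × Fin (T / L)), ‖a c.1 * b c.2‖ ^ 2 = ‖a‖ ^ 2 * ‖b‖ ^ 2 := by
      rw [EuclideanSpace.norm_sq_eq, EuclideanSpace.norm_sq_eq, Finset.sum_mul_sum,
        Fintype.sum_prod_type]
      simp only [norm_mul, mul_pow]
    rw [e]
    exact mul_le_one₀ (pow_le_one₀ (norm_nonneg _) ha) (by positivity)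
      (pow_le_one₀ (norm_nonneg _) hb)
  have h' := h.mono (d := sigmaXNN α σ ^ 2) (by
    gcongr
    exact mul_le_of_le_one_right' hle)
  have h3 := measure_abs_gt_le h' hτ
  rw [coe_sigmaXNN (lambdaStar_lt_one α hx.norm_root_lt_one).le] at h3
  convert h3 using 6
  rw [noiseMap, inner_toEuclideanLin]
  rfl

/-- Operator norm of the noise. -/
theorem measure_noiseMap_norm_le (hp : ∀ n, 1 ≤ p n) (hx : StationaryAR μ α η x)
    (hη : SubgaussianNoise μ η σ) {L T : ℕ} (hLN : N * (T / L) = L) (hL : 1 ≤ L) :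
    μ {ω | ¬ ∀ b, ‖noiseMap x L T ω b‖ ≤ 4 * (sigmaX α σ * √(48 * L)) * ‖b‖} ≤
      ENNReal.ofReal (2 / (L : ℝ) ^ 20) := by
  obtain ⟨S, hSc, hS1, hS⟩ := exists_half_net (E := EuclideanSpace ℝ (Fin N × Fin (T / L)))
  obtain ⟨S', hSc', hS1', hS'⟩ := exists_half_net (E := EuclideanSpace ℝ (Fin L))
  have hσ : 0 ≤ sigmaX α σ := by
    rw [← coe_sigmaXNN (lambdaStar_lt_one α hx.norm_root_lt_one).le]; exact NNReal.coe_nonneg _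
  have h := measure_exists_le (μ := μ) (S ×ˢ S')
    (fun c => {ω | sigmaX α σ * √(48 * L) < |⟪c.2, noiseMap x L T ω c.1⟫_ℝ|}) fun c hc =>
      measure_inner_noiseMap_gt_le hp hx hη (hS1' _ (Finset.mem_product.1 hc).2)
        (hS1 _ (Finset.mem_product.1 hc).1) (Real.sqrt_nonneg _)
  refine (measure_mono fun ω hω => ?_).trans (h.trans (ENNReal.ofReal_le_ofReal ?_))
  · by_contra hcon
    refine hω fun b => norm_le_of_half_nets hS hS' _ (by positivity) (fun b hb a ha => ?_) b
    by_contra hba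
    exact hcon ⟨(b, a), Finset.mem_product.2 ⟨hb, ha⟩, not_le.1 hba⟩
  -- The tail e^(−24L) beats the at most 25^L ≤ e^(4L) net pairs and leaves e^(−20L) ≤ L^(−20); this
  -- fixes the 48.
  · have h1 : ((S ×ˢ S').card : ℝ) ≤ 25 ^ L := by
      rw [Finset.card_product]
      have e1 : finrank ℝ (EuclideanSpace ℝ (Fin N × Fin (T / L))) = L := by simp [hLN]
      have e2 : finrank ℝ (EuclideanSpace ℝ (Fin L)) = L := by simp
      rw [e1] at hSc
      rw [e2] at hSc'
      calc ((S.card * S'.card : ℕ) : ℝ) ≤ ((5 ^ L * 5 ^ L : ℕ) : ℝ) := by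
            exact_mod_cast Nat.mul_le_mul hSc hSc'
        _ = 25 ^ L := by push_cast; rw [← mul_pow]; norm_num
    have h2 : (25 : ℝ) ^ L ≤ Real.exp (4 * L) := by
      have : (25 : ℝ) ≤ Real.exp 4 := by
        have := Real.exp_one_gt_d9
        calc (25 : ℝ) ≤ 2.7 ^ 4 := by norm_num
          _ ≤ Real.exp 1 ^ 4 := by gcongr; linarith
          _ = _ := by rw [← Real.exp_nat_mul]; norm_num
      calc (25 : ℝ) ^ L ≤ Real.exp 4 ^ L := by gcongr
        _ = _ := by rw [← Real.exp_nat_mul]; ring_nf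
    have h3 : (L : ℝ) ^ 20 ≤ Real.exp (20 * L) := by
      have : (L : ℝ) ≤ Real.exp L := by linarith [Real.add_one_le_exp (L : ℝ)]
      calc (L : ℝ) ^ 20 ≤ Real.exp L ^ 20 := by gcongr
        _ = _ := by rw [← Real.exp_nat_mul]; norm_num
    have hLp : (0 : ℝ) < L := by exact_mod_cast hL
    rw [Real.sq_sqrt (by positivity)]
    calc _ ≤ Real.exp (4 * L) * (2 * Real.exp (-(48 * L) / 2)) := by
          gcongr; exact h1.trans h2
      _ = 2 * Real.exp (-(20 * L)) := by
          rw [mul_left_comm, ← Real.exp_add]; ring_nf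
      _ = 2 / Real.exp (20 * L) := by rw [Real.exp_neg]; rfl
      _ ≤ _ := by gcongr

/-- Projections of the columns of the noise onto a fixed subspace. -/
theorem measure_starProjection_noiseMap_le (hp : ∀ n, 1 ≤ p n) (hx : StationaryAR μ α η x)
    (hη : SubgaussianNoise μ η σ) {L T : ℕ} (hLN : N * (T / L) = L) (hL : 1 ≤ L)
    (U : Submodule ℝ (EuclideanSpace ℝ (Fin L))) :
    μ {ω | ¬ ∀ c, ‖U.starProjection (noiseMap x L T ω (EuclideanSpace.single c 1))‖ ^ 2 ≤
        finrank ℝ U * (sigmaX α σ ^ 2 * (44 * Real.log L))} ≤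
      ENNReal.ofReal (2 / (L : ℝ) ^ 20) := by
  have hlog : 0 ≤ Real.log L := Real.log_nonneg (by exact_mod_cast hL)
  set e := stdOrthonormalBasis ℝ U
  have h := measure_exists_le (μ := μ)
    (Finset.univ : Finset (Fin (finrank ℝ U) × (Fin N × Fin (T / L))))
    (fun c => {ω | sigmaX α σ * √(44 * Real.log L) <
      |⟪(e c.1 : EuclideanSpace ℝ (Fin L)), noiseMap x L T ω (EuclideanSpace.single c.2 1)⟫_ℝ|})
    fun c _ => measure_inner_noiseMap_gt_le hp hx hη
      (by rw [← Submodule.coe_norm, e.orthonormal.1]) (by simp) (Real.sqrt_nonneg _)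
  have hσ : 0 ≤ sigmaX α σ := by
    rw [← coe_sigmaXNN (lambdaStar_lt_one α hx.norm_root_lt_one).le]; exact NNReal.coe_nonneg _
  refine (measure_mono fun ω hω => ?_).trans (h.trans (ENNReal.ofReal_le_ofReal ?_))
  · by_contra hcon
    refine hω fun c => ?_
    rw [norm_sq_starProjection]
    have : ∀ i ∈ Finset.univ, ⟪(e i : EuclideanSpace ℝ (Fin L)),
        noiseMap x L T ω (EuclideanSpace.single c 1)⟫_ℝ ^ 2 ≤
          sigmaX α σ ^ 2 * (44 * Real.log L) := by
      intro i _
      have h1 : |⟪(e i : EuclideanSpace ℝ (Fin L)),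
          noiseMap x L T ω (EuclideanSpace.single c 1)⟫_ℝ| ≤ sigmaX α σ * √(44 * Real.log L) := by
        by_contra hba
        exact hcon ⟨(i, c), Finset.mem_univ _, not_le.1 hba⟩
      have h2 := pow_le_pow_left₀ (abs_nonneg _) h1 2
      rwa [sq_abs, mul_pow, Real.sq_sqrt (by positivity)] at h2
    refine (Finset.sum_le_sum this).trans_eq ?_
    simp
  -- The tail L^(−22), from 44 log L, pays for at most L² pairs of a basis vector and a column.
  · have hLp : (0 : ℝ) < L := by exact_mod_cast hL
    have h1 : ((Finset.univ : Finset (Fin (finrank ℝ U) × (Fin N × Fin (T / L)))).card : ℝ) ≤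
        (L : ℝ) ^ 2 := by
      have h2 : finrank ℝ U ≤ L := by simpa using Submodule.finrank_le U
      rw [Finset.card_univ, Fintype.card_prod, Fintype.card_prod, Fintype.card_fin,
        Fintype.card_fin, Fintype.card_fin, hLN, sq]
      exact_mod_cast Nat.mul_le_mul_right L h2
    rw [Real.sq_sqrt (by positivity)]
    have h3 : Real.exp (-(44 * Real.log L) / 2) = ((L : ℝ) ^ 22)⁻¹ := by
      rw [show -(44 * Real.log L) / 2 = -((22 : ℕ) * Real.log L) by push_cast; ring, Real.exp_neg,
        Real.exp_nat_mul, Real.exp_log hLp]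
    rw [h3]
    calc _ ≤ (L : ℝ) ^ 2 * (2 * ((L : ℝ) ^ 22)⁻¹) := by gcongr
      _ = _ := by field_simp

end Concentration

/-! ### From column errors to the estimation error. -/

section Assembly

theorem sum_Icc_one_mul (g : ℕ → ℝ) (L m : ℕ) :
    ∑ t ∈ Finset.Icc 1 (m * L), g t =
      ∑ j : Fin m, ∑ i : Fin L, g (1 + i + j * L) := by
  have h : ∀ m : ℕ, ∑ t ∈ Finset.range (m * L), g (t + 1) =
      ∑ j ∈ Finset.range m, ∑ i ∈ Finset.range L, g (1 + i + j * L) := by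
    intro m
    induction m with
    | zero => simp
    | succ m ih =>
      rw [Nat.succ_mul, Finset.sum_range_add, ih, Finset.sum_range_succ]
      congr 1
      exact Finset.sum_congr rfl fun i _ => by congr 1; ring
  rw [← Finset.Ico_add_one_right_eq_Icc, Finset.sum_Ico_eq_sum_range]
  simp only [Nat.add_sub_cancel, add_comm 1]
  rw [h, Finset.sum_range]
  refine Finset.sum_congr rfl fun j _ => ?_
  rw [Finset.sum_range]
  simp only [add_comm 1]

/-- The estimation error is controlled by the errors of the columns. -/
theorem estErr_le {N L T : ℕ} (hL : 1 ≤ L) (hT : 1 ≤ T) (hLT : L ∣ T) (g f : Fin N → ℕ → ℝ)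
    (n : Fin N) {D : ℝ}
    (h : ∀ c, ∑ i, (stackedPage g L T 1 i c - stackedPage f L T 1 i c) ^ 2 ≤ D) :
    estErr T g f n ≤ D / L := by
  have hTL : T / L * L = T := Nat.div_mul_cancel hLT
  have hs : ∑ t ∈ Finset.Icc 1 T, (g n t - f n t) ^ 2 ≤ (T / L : ℕ) * D := by
    conv_lhs => rw [← hTL]
    rw [sum_Icc_one_mul]
    refine (Finset.sum_le_sum (g := fun _ => D) fun j _ => h (n, j)).trans_eq ?_
    simp
  have hL0 : (0 : ℝ) < L := by exact_mod_cast hL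
  have hT0 : (0 : ℝ) < T := by exact_mod_cast hT
  have hc : ((T / L : ℕ) : ℝ) = T / L := Nat.cast_div hLT hL0.ne'
  rw [hc] at hs
  rw [estErr]
  calc _ ≤ 1 / (T : ℝ) * ((T : ℝ) / L * D) := by gcongr
    _ = _ := by field_simp

theorem toEuclideanLin_single {m n : Type*} [Fintype m] [Fintype n] [DecidableEq n]
    (A : Matrix m n ℝ) (c : n) (i : m) :
    Matrix.toEuclideanLin A (EuclideanSpace.single c 1) i = A i c := by
  simp [Matrix.toLpLin_apply]

theorem toEuclideanLin_eq_sum {m n ι : Type*} [Fintype m] [Fintype n] [DecidableEq n]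
    (t : Finset ι) (s : ι → ℝ) (u : ι → EuclideanSpace ℝ m) (v : ι → EuclideanSpace ℝ n)
    {A : Matrix m n ℝ} (h : ∀ i j, A i j = ∑ l ∈ t, s l * u l i * v l j)
    (b : EuclideanSpace ℝ n) :
    Matrix.toEuclideanLin A b = ∑ l ∈ t, (s l * ⟪v l, b⟫_ℝ) • u l := by
  ext i
  rw [Matrix.toLpLin_apply]
  simp only [Matrix.mulVec, dotProduct, h, Finset.sum_mul, WithLp.ofLp_sum, Finset.sum_apply,
    WithLp.ofLp_smul, Pi.smul_apply, smul_eq_mul, PiLp.inner_apply, RCLike.inner_apply,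
    conj_trivial, Finset.mul_sum]
  rw [Finset.sum_comm]
  exact Finset.sum_congr rfl fun l _ => Finset.sum_congr rfl fun j _ => by ring

theorem abs_le_fMax {N T : ℕ} (f : Fin N → ℕ → ℝ) (n : Fin N) {t : ℕ} (h1 : 1 ≤ t)
    (h2 : t ≤ 2 * T) : |f n t| ≤ fMax f T := by
  have h : ‖f n t‖₊ ≤ fMax f T :=
    Finset.le_sup (f := fun q : Fin N × ℕ => ‖f q.1 q.2‖₊) (b := (n, t))
      (Finset.mem_product.2 ⟨Finset.mem_univ n, Finset.mem_Icc.2 ⟨h1, h2⟩⟩)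
  exact_mod_cast h

theorem norm_sq_page_column_le {N L T : ℕ} (hLT : L ∣ T) (f : Fin N → ℕ → ℝ)
    (c : Fin N × Fin (T / L)) :
    ‖Matrix.toEuclideanLin (stackedPage f L T 1) (EuclideanSpace.single c 1)‖ ^ 2 ≤
      L * (fMax f T : ℝ) ^ 2 := by
  rw [EuclideanSpace.norm_sq_eq]
  have h : ∀ i ∈ Finset.univ, ‖Matrix.toEuclideanLin (stackedPage f L T 1)
      (EuclideanSpace.single c 1) i‖ ^ 2 ≤ (fMax f T : ℝ) ^ 2 := by
    intro i _
    rw [toEuclideanLin_single, Real.norm_eq_abs]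
    have h1 : 1 + (i : ℕ) + (c.2 : ℕ) * L ≤ T := by
      have h2 : ((c.2 : ℕ) + 1) * L ≤ T / L * L := Nat.mul_le_mul_right L c.2.2
      rw [Nat.div_mul_cancel hLT] at h2
      have := i.2
      nlinarith
    exact pow_le_pow_left₀ (abs_nonneg _) (abs_le_fMax f c.1 (by omega) (by omega)) 2
  refine (Finset.sum_le_sum h).trans_eq ?_
  simp

/-- The factor L in `X` and `F` cancels the 1/L in (2B/d)². The three terms cost 88, 4·3072·768 =
9437184 and 6144, together below 10⁷. -/
theorem error_arithmetic {k L lg σ γ f PX X F d B : ℝ} (hk : 1 ≤ k) (hL : 0 < L) (hlg : 1 ≤ lg)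
    (hγ : 0 < γ) (hf : 0 ≤ f) (hd : d = γ * L / √k)
    (hB : B = 4 * (σ * √(48 * L))) (hPX : PX ≤ k * (σ ^ 2 * (22 * lg)))
    (hX : X ≤ B ^ 2) (hF : F ≤ L * f ^ 2) :
    4 * PX + 4 * (2 * B / d) ^ 2 * X + 2 * (2 * B / d) ^ 2 * F ≤
      10 ^ 7 * (1 + f) ^ 2 * (1 + γ⁻¹) ^ 2 * (max (σ ^ 2) (σ ^ 4) * k * lg) := by
  set M := max (σ ^ 2) (σ ^ 4) with hM
  have hM2 : σ ^ 2 ≤ M := le_max_left _ _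
  have hM4 : σ ^ 4 ≤ M := le_max_right _ _
  have hM0 : 0 ≤ M := (sq_nonneg σ).trans hM2
  have hB2 : B ^ 2 = 768 * σ ^ 2 * L := by
    rw [hB, mul_pow, mul_pow, Real.sq_sqrt (by positivity)]; ring
  have hκ : (2 * B / d) ^ 2 = 3072 * σ ^ 2 * k * γ⁻¹ ^ 2 / L := by
    rw [div_pow, mul_pow, hB2, hd, div_pow, Real.sq_sqrt (by positivity)]
    field_simp
    ring
  have hγ' : 0 < γ⁻¹ := inv_pos.2 hγ
  set g := γ⁻¹
  set W := (1 + f) ^ 2 * (1 + g) ^ 2 * (M * k * lg) with hW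
  have hMk : 0 ≤ M * k * lg := by positivity
  have w1 : M * k * lg ≤ W := by
    have : 1 ≤ (1 + f) ^ 2 * (1 + g) ^ 2 :=
      one_le_mul_of_one_le_of_one_le (one_le_pow₀ (by linarith)) (one_le_pow₀ (by linarith))
    exact le_mul_of_one_le_left hMk this
  have hlgk : M * k ≤ M * k * lg := le_mul_of_one_le_right (by positivity) hlg
  have w2 : g ^ 2 * (M * k) ≤ W := by
    have : g ^ 2 ≤ (1 + f) ^ 2 * (1 + g) ^ 2 := by
      calc g ^ 2 = 1 * g ^ 2 := by ring
        _ ≤ (1 + f) ^ 2 * (1 + g) ^ 2 := by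
          gcongr
          · exact one_le_pow₀ (by linarith)
          · linarith
    calc _ ≤ ((1 + f) ^ 2 * (1 + g) ^ 2) * (M * k * lg) := by gcongr
      _ = W := rfl
  have w3 : f ^ 2 * g ^ 2 * (M * k) ≤ W := by
    have : f ^ 2 * g ^ 2 ≤ (1 + f) ^ 2 * (1 + g) ^ 2 := by
      gcongr <;> linarith
    calc _ ≤ ((1 + f) ^ 2 * (1 + g) ^ 2) * (M * k * lg) := by gcongr
      _ = W := rfl
  have t1 : 4 * PX ≤ 88 * (M * k * lg) := by
    calc 4 * PX ≤ 4 * (k * (σ ^ 2 * (22 * lg))) := by gcongr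
      _ = 88 * (σ ^ 2 * k * lg) := by ring
      _ ≤ _ := by gcongr
  have t2 : 4 * (2 * B / d) ^ 2 * X ≤ 9437184 * (g ^ 2 * (M * k)) := by
    calc _ ≤ 4 * (2 * B / d) ^ 2 * B ^ 2 := by gcongr
      _ = 9437184 * (g ^ 2 * (σ ^ 4 * k)) := by
        rw [hκ, hB2]; field_simp; ring
      _ ≤ _ := by gcongr
  have t3 : 2 * (2 * B / d) ^ 2 * F ≤ 6144 * (f ^ 2 * g ^ 2 * (M * k)) := by
    calc _ ≤ 2 * (2 * B / d) ^ 2 * (L * f ^ 2) := by gcongr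
      _ = 6144 * (f ^ 2 * g ^ 2 * (σ ^ 2 * k)) := by
        rw [hκ]; field_simp; ring
      _ ≤ _ := by gcongr
  have hW0 : 0 ≤ W := hMk.trans w1
  calc _ ≤ 10 ^ 7 * W := by linarith
    _ = _ := by rw [hW]; ring

/-- Error of the columns of the estimated matrix on the event where the noise is small. -/
theorem column_error_le {N L T : ℕ} (hL : 1 ≤ L) (hLT : L ∣ T) (hLL : (L : ℝ) = √((N : ℝ) * T))
    {f g y : Fin N → ℕ → ℝ} {γ σ lg : ℝ} (hγ : 0 < γ) (hσ : 0 ≤ σ) (hlg : 1 ≤ lg)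
    (hbal : BalancedSpectra f L T γ)
    (hg : IsMSSAEstimate L T (stackedPage f L T 1).rank (fun n t => f n t + y n t) g)
    (hop : ∀ b, ‖Matrix.toEuclideanLin (stackedPage y L T 1) b‖ ≤ 4 * (σ * √(48 * L)) * ‖b‖)
    (hproj : ∀ c, ‖(Matrix.toEuclideanLin (stackedPage f L T 1)).range.starProjection
      (Matrix.toEuclideanLin (stackedPage y L T 1) (EuclideanSpace.single c 1))‖ ^ 2 ≤
        finrank ℝ (Matrix.toEuclideanLin (stackedPage f L T 1)).range * (σ ^ 2 * (22 * lg)))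
    (c : Fin N × Fin (T / L)) :
    ∑ i, (stackedPage g L T 1 i c - stackedPage f L T 1 i c) ^ 2 ≤
      10 ^ 7 * (1 + (fMax f T : ℝ)) ^ 2 * (1 + γ⁻¹) ^ 2 *
        (max (σ ^ 2) (σ ^ 4) * (stackedPage f L T 1).rank * lg) := by
  obtain ⟨r, s, u, v, hu, hv, hs, hs0, hY, hYhat⟩ := hg
  set A := Matrix.toEuclideanLin (stackedPage f L T 1) with hA
  set X := Matrix.toEuclideanLin (stackedPage y L T 1) with hX
  have hrank : (stackedPage f L T 1).rank = finrank ℝ A.range :=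
    rank_eq_finrank_range_toEuclideanLin _
  rw [hrank] at hYhat ⊢
  have hsum : ∀ b, A b + X b = ∑ l, (s l * ⟪v l, b⟫_ℝ) • u l := by
    intro b
    rw [← toEuclideanLin_eq_sum _ s u v hY b, hA, hX, ← LinearMap.add_apply, ← map_add]
    rfl
  have hhat : ∀ b, Matrix.toEuclideanLin (stackedPage g L T 1) b =
      ∑ l ∈ Finset.univ.filter (fun l : Fin r => (l : ℕ) < finrank ℝ A.range),
        (s l * ⟪v l, b⟫_ℝ) • u l := fun b =>
    toEuclideanLin_eq_sum _ s u v (fun i j => by rw [hYhat, Finset.sum_filter]) b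
  have herr : ∑ i, (stackedPage g L T 1 i c - stackedPage f L T 1 i c) ^ 2 =
      ‖(∑ l ∈ Finset.univ.filter (fun l : Fin r => (l : ℕ) < finrank ℝ A.range),
        (s l * ⟪v l, EuclideanSpace.single c (1 : ℝ)⟫_ℝ) • u l) -
          A (EuclideanSpace.single c 1)‖ ^ 2 := by
    rw [← hhat, EuclideanSpace.norm_sq_eq]
    refine Finset.sum_congr rfl fun i _ => ?_
    rw [PiLp.sub_apply, toEuclideanLin_single, hA, toEuclideanLin_single, Real.norm_eq_abs, sq_abs]
  rw [herr]
  have hL0 : (0 : ℝ) < L := by exact_mod_cast hL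
  -- At rank zero the spectral assumption is silent, but signal and estimate both vanish.
  rcases Nat.eq_zero_or_pos (finrank ℝ A.range) with hk | hk
  · have hA0 : ∀ b, A b = 0 := fun b => by
      have h1 : A b ∈ A.range := LinearMap.mem_range_self _ _
      rwa [Submodule.finrank_eq_zero.1 hk, Submodule.mem_bot] at h1
    rw [hk, hA0]
    simp
  · obtain ⟨j, hj⟩ : ∃ j, finrank ℝ A.range = j + 1 := ⟨_, (Nat.succ_pred_eq_of_pos hk).symm⟩
    have hb := hbal 1 le_rfl j (hrank.trans hj)
    rw [← hLL] at hb
    set d := γ * L / √((j : ℝ) + 1) with hd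
    have hd0 : 0 < d := by positivity
    have hcast : ((finrank ℝ A.range : ℕ) : ℝ) = (j : ℝ) + 1 := by rw [hj]; push_cast; rfl
    have herr := hsvt_error hu hv hs hs0 hsum hd0 hop
      (fun a ha => (mul_le_mul_of_nonneg_right hb (norm_nonneg a)).trans
        (singularValues_mul_norm_le A hj ha)) (EuclideanSpace.single c 1) (by positivity)
    refine herr.trans (error_arithmetic (L := L) ?_ hL0 hlg hγ (NNReal.coe_nonneg _) ?_ rfl
      (hproj c) ?_ (norm_sq_page_column_le hLT f c))
    · exact_mod_cast hk
    · rw [hd, hcast]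
    · have := hop (EuclideanSpace.single c 1)
      rw [PiLp.norm_single, norm_one, mul_one] at this
      exact pow_le_pow_left₀ (norm_nonneg _) this 2

end Assembly

end SAMoSSA

end

theorem theorem1 :
    ∃ (c K : ℝ) (a b : ℕ), 0 < c ∧ 0 < K ∧
      ∀ (Ω : Type u) [MeasurableSpace Ω] (μ : Measure Ω) [IsProbabilityMeasure μ]
        (N T L R G : ℕ) (_ : 1 ≤ N) (_ : N ≤ T) (_ : (L : ℝ) = √((N : ℝ) * T)) (_ : L ∣ T)
        (f : Fin N → ℕ → ℝ) (coef : Fin N → Fin R → ℝ) (w : Fin R → ℕ → ℝ)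
        (p : Fin N → ℕ) (_ : ∀ n, 1 ≤ p n) (α : ∀ n, Fin (p n) → ℝ)
        (η x : Fin N → ℤ → Ω → ℝ) (σ : ℝ≥0) (γ : ℝ) (_ : 0 < γ)
        (_ : SAMoSSA.SpatialStructure f coef w)
        (_ : SAMoSSA.TemporalStructure w G)
        (_ : SAMoSSA.StationaryAR μ α η x)
        (_ : SAMoSSA.SubgaussianNoise μ η σ)
        (_ : SAMoSSA.BalancedSpectra f L T γ)
        (fhat : Ω → Fin N → ℕ → ℝ)
        (_ : ∀ ω, SAMoSSA.IsMSSAEstimate L T (SAMoSSA.stackedPage f L T 1).rank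
          (SAMoSSA.observation f x ω) (fhat ω)),
        ∀ n : Fin N,
          μ {ω | ¬ SAMoSSA.estErr T (fhat ω) f n ≤
              K * (1 + (SAMoSSA.fMax f T : ℝ)) ^ a * (1 + γ⁻¹) ^ b *
                (max (SAMoSSA.sigmaX α σ ^ 2) (SAMoSSA.sigmaX α σ ^ 4) * G * R *
                  Real.log ((N : ℝ) * T) / √((N : ℝ) * T))} ≤
            ENNReal.ofReal (c / ((N : ℝ) * T) ^ 10) := by
  -- The 4 adds two failure probabilities 2 / L^20, where L^20 = (NT)^10.
  refine ⟨4, 10 ^ 7, 2, 2, by norm_num, by norm_num, ?_⟩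
  intro Ω _ μ _ N T L R G hN hNT hLL hLT f coef w p hp α η x σ γ hγ hf hw hx hη hbal fhat hfhat n
  have hT : 1 ≤ T := hN.trans hNT
  have hsq : L * L = N * T := by
    have h : (L : ℝ) * L = (N : ℝ) * T := by rw [hLL, Real.mul_self_sqrt (by positivity)]
    exact_mod_cast h
  have hNT1 : 1 ≤ N * T := Nat.mul_pos hN hT
  have hL : 1 ≤ L := by
    by_contra h
    have h0 : L = 0 := by omega
    rw [h0] at hsq
    omega
  have hLN : N * (T / L) = L := by
    have h1 : T / L * L = T := Nat.div_mul_cancel hLT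
    refine Nat.eq_of_mul_eq_mul_right hL ?_
    rw [mul_assoc, h1, hsq]
  have hNTL : (N : ℝ) * T = (L : ℝ) ^ 2 := by
    rw [sq]; exact_mod_cast hsq.symm
  -- At T = 1 the logarithm vanishes and the rank assumption does not apply, but the probability
  -- bound 4 is trivial. For T > 1, L ≥ 2 and log(NT) ≥ log 4 ≥ 1.
  rcases hT.eq_or_lt with hT1 | hT1
  · have hN1 : N = 1 := by omega
    refine prob_le_one.trans ?_
    rw [← hT1, hN1]
    norm_num
  have hL2 : 2 ≤ L := by
    by_contra h
    have h1 : L = 1 := by omega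
    rw [h1] at hsq
    nlinarith
  have hσ : 0 ≤ SAMoSSA.sigmaX α σ := by
    rw [← SAMoSSA.coe_sigmaXNN (SAMoSSA.lambdaStar_lt_one α hx.norm_root_lt_one).le]
    exact NNReal.coe_nonneg _
  have hlogL : Real.log ((N : ℝ) * T) = 2 * Real.log L := by
    rw [hNTL, Real.log_pow]; norm_num
  have hlog : 1 ≤ Real.log ((N : ℝ) * T) := by
    have h2 : (2 : ℝ) ≤ L := by exact_mod_cast hL2
    rw [hNTL, Real.le_log_iff_exp_le (by positivity)]
    have := Real.exp_one_lt_d9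
    nlinarith
  have h1 := SAMoSSA.measure_noiseMap_norm_le hp hx hη (T := T) hLN hL
  have h2 := SAMoSSA.measure_starProjection_noiseMap_le hp hx hη (T := T) hLN hL
    (Matrix.toEuclideanLin (SAMoSSA.stackedPage f L T 1)).range
  refine (measure_mono fun ω hω => ?_).trans ((measure_union_le _ _).trans
    ((add_le_add h1 h2).trans_eq ?_))
  · by_contra hcon
    rw [Set.mem_union, not_or] at hcon
    have hop := not_not.1 hcon.1
    have hproj := not_not.1 hcon.2
    refine hω ?_
    have hcol := SAMoSSA.column_error_le hL hLT hLL hγ hσ hlog hbal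
      (y := fun n t => x n (t : ℤ) ω) (hfhat ω) hop (fun c => by
        refine (hproj c).trans_eq ?_
        rw [hlogL]; ring)
    refine (SAMoSSA.estErr_le hL hT hLT _ _ n hcol).trans ?_
    have hrank : ((SAMoSSA.stackedPage f L T 1).rank : ℝ) ≤ G * R := by
      exact_mod_cast SAMoSSA.rank_stackedPage_le hf hw hT1 hL (Nat.le_of_dvd hT hLT) le_rfl
    have hM : 0 ≤ max (SAMoSSA.sigmaX α σ ^ 2) (SAMoSSA.sigmaX α σ ^ 4) :=
      (sq_nonneg _).trans (le_max_left _ _)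
    have hlog0 : 0 ≤ Real.log ((N : ℝ) * T) := by linarith
    rw [← hLL, mul_div_assoc, mul_assoc (max _ _) (G : ℝ) (R : ℝ)]
    gcongr
  · rw [← ENNReal.ofReal_add (by positivity) (by positivity), hNTL]
    congr 1
    ring
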